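/- Let $\alpha_i\in\mathbb{C}$ and $f_i\in\mathbb{C}(t)$ ($i\in\mathbb{Z}/6\mathbb{Z}$) form a rational solution of the $A_5^{(1)}$ Painlevé equation, that is, for all $i\in\mathbb{Z}/6\mathbb{Z}$, $$\tfrac{t}{2}f_i'=f_i\left(f_{i+1}f_{i+2}+f_{i+1}f_{i+4}+f_{i+3}f_{i+4}-f_{i+2}f_{i+3}-f_{i+2}f_{i+5}-f_{i+4}f_{i+5}\right)+\left(\tfrac12-\alpha_{i+2}-\alpha_{i+4}\right)f_i+\alpha_i\left(f_{i+2}+f_{i+4}\right),$$ and $f_0+f_2+f_4=f_1+f_3+f_5=t$, $\alpha_0+\alpha_1+\cdots+\alpha_5=1$. Put $$\begin{aligned} \tilde h_i={}&\sum_{j=0}^{5}f_jf_{j+1}f_{j+2}f_{j+3}\\ &+\tfrac13(\alpha_{i+1}+2\alpha_{i+2}+\alpha_{i+4}-\alpha_{i+5})f_if_{i+1} +\tfrac13(\alpha_{i+1}+2\alpha_{i+2}+3\alpha_{i+3}+\alpha_{i+4}+2\alpha_{i+5})f_{i+1}f_{i+2}\\ &-\tfrac13(2\alpha_{i+1}+\alpha_{i+2}-\alpha_{i+4}+\alpha_{i+5})f_{i+2}f_{i+3}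 +\tfrac13(\alpha_{i+1}-\alpha_{i+2}+\alpha_{i+4}+2\alpha_{i+5})f_{i+3}f_{i+4}\\ &-\tfrac13(2\alpha_{i+1}+\alpha_{i+2}+3\alpha_{i+3}+2\alpha_{i+4}+\alpha_{i+5})f_{i+4}f_{i+5} +\tfrac13(\alpha_{i+1}-\alpha_{i+2}-2\alpha_{i+4}-\alpha_{i+5})f_{i+5}f_i\\ &+\tfrac13(\alpha_{i+1}-\alpha_{i+2}+\alpha_{i+4}-\alpha_{i+5})f_if_{i+3} +\tfrac13(\alpha_{i+1}+2\alpha_{i+2}+\alpha_{i+4}+2\alpha_{i+5})f_{i+1}f_{i+4}\\ &-\tfrac13(2\alpha_{i+1}+\alpha_{i+2}+2\alpha_{i+4}+\alpha_{i+5})f_{i+2}f_{i+5}, \end{aligned}$$ and $H=\frac16\sum_{i=0}^{5}\tilde h_i$. Let $h_{0,0}$ and $h_{\infty,0}$ be the constant terms of the Laurent expansions of the rational function $H$ at $t=0$ and at $t=\infty$. If some $f_i$ has a pole in $\mathbb{C}^*=\mathbb{C}\setminus\{0\}$, then $6(h_{0,0}-h_{\infty,0})$ is a negative integer. In particular, if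 $h_{0,0}-h_{\infty,0}=0$, then all $f_i$ are regular on $\mathbb{C}^*$. -/

import Mathlib

namespace PainleveA5

/-- The derivative `f'` of a rational function `f` in the variable `t`, by the quotient rule. -/
noncomputable def ratDeriv (f : RatFunc ℂ) : RatFunc ℂ :=
  algebraMap (Polynomial ℂ) (RatFunc ℂ)
      (Polynomial.derivative f.num * f.denom - f.num * Polynomial.derivative f.denom) /
    algebraMap (Polynomial ℂ) (RatFunc ℂ) (f.denom ^ 2)

/-- `f` has a pole at the finite point `c` (the denominator is taken in lowest terms). -/
def HasPoleAt (f : RatFunc ℂ) (c : ℂ) : Prop := f.denom.eval c = 0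

/-- `f` is regular (holomorphic) at the finite point `c`. -/
def IsRegularAt (f : RatFunc ℂ) (c : ℂ) : Prop := ¬ HasPoleAt f c

/-- `(f_i)` is a rational solution of the `A_5^{(1)}` Painlevé equation with parameters `(α_i)`.
Indices are in `ℤ/6ℤ`, and the variable `t` is `RatFunc.X`. -/
structure IsRationalSolution (α : ZMod 6 → ℂ) (f : ZMod 6 → RatFunc ℂ) : Prop where
  ode : ∀ i : ZMod 6,
    RatFunc.X / 2 * ratDeriv (f i) =
      f i * (f (i + 1) * f (i + 2) + f (i + 1) * f (i + 4) + f (i + 3) * f (i + 4)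
          - f (i + 2) * f (i + 3) - f (i + 2) * f (i + 5) - f (i + 4) * f (i + 5))
        + RatFunc.C (1 / 2 - α (i + 2) - α (i + 4)) * f i
        + RatFunc.C (α i) * (f (i + 2) + f (i + 4))
  sum_even : f 0 + f 2 + f 4 = RatFunc.X
  sum_odd : f 1 + f 3 + f 5 = RatFunc.X
  sum_param : α 0 + α 1 + α 2 + α 3 + α 4 + α 5 = 1

/-- The Noumi–Yamada Hamiltonian `h_i`. -/
noncomputable def hamiltonian (α : ZMod 6 → ℂ) (f : ZMod 6 → RatFunc ℂ) (i : ZMod 6) :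
    RatFunc ℂ :=
  (∑ j : ZMod 6, f j * f (j + 1) * f (j + 2) * f (j + 3))
    + RatFunc.C (1 / 3 * (α (i + 1) + 2 * α (i + 2) + α (i + 4) - α (i + 5)))
        * (f i * f (i + 1))
    + RatFunc.C (1 / 3 * (α (i + 1) + 2 * α (i + 2) + 3 * α (i + 3) + α (i + 4) + 2 * α (i + 5)))
        * (f (i + 1) * f (i + 2))
    - RatFunc.C (1 / 3 * (2 * α (i + 1) + α (i + 2) - α (i + 4) + α (i + 5)))
        * (f (i + 2) * f (i + 3))
    + RatFunc.C (1 / 3 * (α (i + 1) - α (i + 2) + α (i + 4) + 2 * α (i + 5)))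
        * (f (i + 3) * f (i + 4))
    - RatFunc.C (1 / 3 * (2 * α (i + 1) + α (i + 2) + 3 * α (i + 3) + 2 * α (i + 4) + α (i + 5)))
        * (f (i + 4) * f (i + 5))
    + RatFunc.C (1 / 3 * (α (i + 1) - α (i + 2) - 2 * α (i + 4) - α (i + 5)))
        * (f (i + 5) * f i)
    + RatFunc.C (1 / 3 * (α (i + 1) - α (i + 2) + α (i + 4) - α (i + 5)))
        * (f i * f (i + 3))
    + RatFunc.C (1 / 3 * (α (i + 1) + 2 * α (i + 2) + α (i + 4) + 2 * α (i + 5)))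
        * (f (i + 1) * f (i + 4))
    - RatFunc.C (1 / 3 * (2 * α (i + 1) + α (i + 2) + 2 * α (i + 4) + α (i + 5)))
        * (f (i + 2) * f (i + 5))
    + RatFunc.C (1 / 4 * (α (i + 1) + α (i + 3) + α (i + 5)) ^ 2)

/-- The Hamiltonian without its constant summand, `h̃_i`. -/
noncomputable def hamiltonianTilde (α : ZMod 6 → ℂ) (f : ZMod 6 → RatFunc ℂ) (i : ZMod 6) :
    RatFunc ℂ :=
  hamiltonian α f i - RatFunc.C (1 / 4 * (α (i + 1) + α (i + 3) + α (i + 5)) ^ 2)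

/-- The auxiliary function `H`, the mean of the six `h̃_i`. -/
noncomputable def auxH (α : ZMod 6 → ℂ) (f : ZMod 6 → RatFunc ℂ) : RatFunc ℂ :=
  RatFunc.C (1 / 6) * ∑ i : ZMod 6, hamiltonianTilde α f i

/-- The constant term of the Laurent expansion of `g` at `t = 0`. -/
noncomputable def constTermZero (g : RatFunc ℂ) : ℂ :=
  (g : LaurentSeries ℂ).coeff 0

/-- The constant term of the Laurent expansion of `g` at `t = ∞`, that is, of the expansion of
`g (1 / s)` at `s = 0`. -/
noncomputable def constTermInfty (g : RatFunc ℂ) : ℂ :=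
  constTermZero (RatFunc.eval RatFunc.C (RatFunc.X)⁻¹ g)

end PainleveA5

/-! The argument is a residue count for `H`. The difference of the constant terms of a rational
function `g` at `0` and `∞` vanishes on Laurent polynomials and equals `-1/c` on `1/(t - c)`. If all
poles of `g` in `ℂ ∖ {0}` are simple, it is therefore `-∑ Res_c g / c` (`constDiff_eq_sum`). Two
facts about `H` then suffice.

Locally, at `c ≠ 0`, `H` has at most a simple pole with residue `m c / 12`, where `m` is a natural
number that can vanish only if every `f i` is regular at `c` (`auxH_leadAt`). To see this, write the
equation as `f i * coupling = lower order terms`. Comparing leading coefficients excludes poles of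
order at least two (`simple_poles`). For simple poles, the residues and constant terms satisfy a
small algebraic system (`poleData`), and a case analysis of it determines `m` (`residueLaw`). The
link to `H` is `deriv_auxH`: along a solution `H'` is only cubic in the `f i`, so its double-pole
coefficient is determined by residues and constant terms.

Globally, every rational solution is odd (`reflection_eq`). In the variable `1/t` the functions `f i
/ t` are regular at infinity and determined by their values there (`ReciprocalSystem.regular`,
`ReciprocalSystem.unique`); the solution `-f(-t)` has the same values. Hence `H` is even and `m`
takes equal values at `c` and `-c`.

So six times the difference of constant terms is `-(∑ m) / 2`. The sum is even by pairing `c` with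
`-c`, and it is positive as soon as some `f i` has a pole. -/

namespace PainleveA5

open Polynomial

/-! ### The derivation `d/dt` on `ℂ(t)` -/

/-- The quotient rule holds for every fraction representing `f`. The definition uses lowest terms,
which sums and products of fractions do not preserve. -/
theorem ratDeriv_eq_of_mul_eq {f : RatFunc ℂ} {p q : ℂ[X]}
    (h : f * algebraMap ℂ[X] (RatFunc ℂ) q = algebraMap ℂ[X] (RatFunc ℂ) p) :
    ratDeriv f * algebraMap ℂ[X] (RatFunc ℂ) (q ^ 2) =
      algebraMap ℂ[X] (RatFunc ℂ) (derivative p * q - p * derivative q) := by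
  have hd : f.denom ≠ 0 := f.denom_ne_zero
  have hd' : algebraMap ℂ[X] (RatFunc ℂ) f.denom ≠ 0 := by simpa using hd
  have hf : f * algebraMap ℂ[X] (RatFunc ℂ) f.denom = algebraMap ℂ[X] (RatFunc ℂ) f.num := by
    nth_rw 1 [← RatFunc.num_div_denom f]
    exact div_mul_cancel₀ _ hd'
  have hpoly : f.num * q = p * f.denom := by
    apply RatFunc.algebraMap_injective ℂ
    rw [map_mul, map_mul, ← hf, ← h]; ring
  have hder : derivative f.num * q + f.num * derivative q =
      derivative p * f.denom + p * derivative f.denom := by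
    rw [← derivative_mul, ← derivative_mul, hpoly]
  have key : (derivative f.num * f.denom - f.num * derivative f.denom) * q ^ 2 =
      (derivative p * q - p * derivative q) * f.denom ^ 2 := by
    linear_combination f.denom * q * hder - (derivative f.denom * q + f.denom * derivative q) * hpoly
  unfold ratDeriv
  rw [div_mul_eq_mul_div, div_eq_iff (by simpa using hd), ← map_mul, ← map_mul, key]

theorem exists_mul_eq (f : RatFunc ℂ) : ∃ p q : ℂ[X], q ≠ 0 ∧
    f * algebraMap ℂ[X] (RatFunc ℂ) q = algebraMap ℂ[X] (RatFunc ℂ) p := by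
  refine ⟨f.num, f.denom, f.denom_ne_zero, ?_⟩
  have hd' : algebraMap ℂ[X] (RatFunc ℂ) f.denom ≠ 0 := by simpa using f.denom_ne_zero
  exact (div_eq_iff hd').1 (RatFunc.num_div_denom f) |>.symm

theorem ratDeriv_add (f g : RatFunc ℂ) : ratDeriv (f + g) = ratDeriv f + ratDeriv g := by
  obtain ⟨p, q, hq, hf⟩ := exists_mul_eq f
  obtain ⟨r, s, hs, hg⟩ := exists_mul_eq g
  have h1 := ratDeriv_eq_of_mul_eq hf
  have h2 := ratDeriv_eq_of_mul_eq hg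
  have h3 := ratDeriv_eq_of_mul_eq (f := f + g) (p := p * s + r * q) (q := q * s)
    (by simp only [map_mul, map_add]; linear_combination algebraMap ℂ[X] (RatFunc ℂ) s * hf +
          algebraMap ℂ[X] (RatFunc ℂ) q * hg)
  have hqs : algebraMap ℂ[X] (RatFunc ℂ) ((q * s) ^ 2) ≠ 0 := by simp [hq, hs]
  apply mul_right_cancel₀ hqs
  rw [h3]
  simp only [map_mul, map_add, map_sub, map_pow, derivative_mul] at h1 h2 ⊢
  linear_combination (-algebraMap ℂ[X] (RatFunc ℂ) s ^ 2) * h1 -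
    algebraMap ℂ[X] (RatFunc ℂ) q ^ 2 * h2

theorem ratDeriv_mul (f g : RatFunc ℂ) : ratDeriv (f * g) = f * ratDeriv g + g * ratDeriv f := by
  obtain ⟨p, q, hq, hf⟩ := exists_mul_eq f
  obtain ⟨r, s, hs, hg⟩ := exists_mul_eq g
  have h1 := ratDeriv_eq_of_mul_eq hf
  have h2 := ratDeriv_eq_of_mul_eq hg
  have h3 := ratDeriv_eq_of_mul_eq (f := f * g) (p := p * r) (q := q * s)
    (by simp only [map_mul]; rw [← hf, ← hg]; ring)
  have hqs : algebraMap ℂ[X] (RatFunc ℂ) ((q * s) ^ 2) ≠ 0 := by simp [hq, hs]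
  apply mul_right_cancel₀ hqs
  rw [h3]
  simp only [map_mul, map_add, map_sub, map_pow, derivative_mul] at h1 h2 ⊢
  rw [← hf, ← hg] at *
  linear_combination (-g * algebraMap ℂ[X] (RatFunc ℂ) s ^ 2) * h1 -
    f * algebraMap ℂ[X] (RatFunc ℂ) q ^ 2 * h2

theorem ratDeriv_algebraMap (p : ℂ[X]) :
    ratDeriv (algebraMap ℂ[X] (RatFunc ℂ) p) = algebraMap ℂ[X] (RatFunc ℂ) (derivative p) := by
  have := ratDeriv_eq_of_mul_eq (f := algebraMap ℂ[X] (RatFunc ℂ) p) (p := p) (q := 1)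
    (by simp)
  simpa using this

theorem ratDeriv_C (a : ℂ) : ratDeriv (RatFunc.C a) = 0 := by
  rw [← RatFunc.algebraMap_C, ratDeriv_algebraMap]; simp

theorem ratDeriv_X : ratDeriv RatFunc.X = 1 := by
  rw [← RatFunc.algebraMap_X, ratDeriv_algebraMap]; simp

/-- The derivation `d/dt` on `ℂ(t)`. -/
noncomputable def ratDerivation : Derivation ℂ (RatFunc ℂ) (RatFunc ℂ) :=
  Derivation.mk'
    { toFun := ratDeriv
      map_add' := ratDeriv_add
      map_smul' := fun r f => by
        rw [RatFunc.smul_eq_C_mul, ratDeriv_mul, ratDeriv_C, mul_zero, add_zero,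
          RingHom.id_apply, RatFunc.smul_eq_C_mul] }
    (fun f g => by simpa using ratDeriv_mul f g)

theorem ratDerivation_apply (f : RatFunc ℂ) : ratDerivation f = ratDeriv f := rfl

theorem ratDeriv_neg (f : RatFunc ℂ) : ratDeriv (-f) = -ratDeriv f := map_neg ratDerivation f

theorem ratDeriv_sub (f g : RatFunc ℂ) : ratDeriv (f - g) = ratDeriv f - ratDeriv g :=
  map_sub ratDerivation f g

theorem ratDeriv_zpow (f : RatFunc ℂ) (hf : f ≠ 0) (k : ℤ) :
    ratDeriv (f ^ k) = (k : RatFunc ℂ) * f ^ (k - 1) * ratDeriv f := by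
  have hpow : ∀ n : ℕ, ratDeriv (f ^ n) = (n : RatFunc ℂ) * f ^ ((n : ℤ) - 1) * ratDeriv f := by
    intro n
    induction n with
    | zero => simpa using ratDeriv_C 1
    | succ n ih =>
      rw [pow_succ, ratDeriv_mul, ih]
      have : f ^ (((n + 1 : ℕ) : ℤ) - 1) = f ^ n := by simp
      rw [this, zpow_sub_one₀ hf, zpow_natCast]
      push_cast
      field_simp
      ring
  obtain ⟨n, rfl | rfl⟩ := k.eq_nat_or_neg
  · simpa using hpow n
  · have h := ratDerivation.leibniz_inv (f ^ n)
    rw [ratDerivation_apply, ratDerivation_apply, hpow] at h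
    rw [zpow_neg, zpow_natCast, h, zpow_sub_one₀ hf, zpow_sub_one₀ hf, zpow_neg, zpow_natCast]
    simp only [smul_eq_mul]
    push_cast
    field_simp

/-- The chain rule for substitutions. -/
theorem ratDeriv_map (σ : RatFunc ℂ →ₐ[ℂ] RatFunc ℂ) (f : RatFunc ℂ) :
    ratDeriv (σ f) = σ (ratDeriv f) * ratDeriv (σ RatFunc.X) := by
  have hσ : ∀ r : ℂ, σ (RatFunc.C r) = RatFunc.C r := fun r => by
    rw [← RatFunc.algebraMap_eq_C]; exact σ.commutes r
  have hpoly : ∀ p : ℂ[X], ratDeriv (σ (algebraMap ℂ[X] (RatFunc ℂ) p)) =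
      σ (algebraMap ℂ[X] (RatFunc ℂ) (derivative p)) * ratDeriv (σ RatFunc.X) := by
    intro p
    induction p using Polynomial.induction_on' with
    | add p q hp hq => simp only [map_add, ratDeriv_add, hp, hq]; ring
    | monomial n a =>
      rw [derivative_monomial, ← C_mul_X_pow_eq_monomial, ← C_mul_X_pow_eq_monomial]
      simp only [map_mul, map_pow, RatFunc.algebraMap_X, RatFunc.algebraMap_C, hσ, ratDeriv_mul,
        ratDeriv_C]
      rw [← zpow_natCast, ratDeriv_zpow _ (by simp [RatFunc.X_ne_zero])]
      rcases n with _ | n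
      · simp
      · simp; ring
  obtain ⟨p, q, hq, hf⟩ := exists_mul_eq f
  have hq' : σ (algebraMap ℂ[X] (RatFunc ℂ) q) ≠ 0 := by simpa using hq
  have h1 := congrArg (fun g => ratDeriv (σ g)) hf
  have h2 := congrArg (fun g => σ (ratDeriv g)) hf
  simp only [map_mul, ratDeriv_mul, hpoly, ratDeriv_algebraMap, map_add] at h1 h2
  apply mul_left_cancel₀ hq'
  linear_combination h1 - ratDeriv (σ RatFunc.X) * h2

/-! ### Leading terms at a point -/

/-- `u` is regular at `c` with value `a`. -/
def HasValueAt (c a : ℂ) (u : RatFunc ℂ) : Prop :=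
  ∃ p q : ℂ[X], q.eval c ≠ 0 ∧ p.eval c = a * q.eval c ∧
    u * algebraMap ℂ[X] (RatFunc ℂ) q = algebraMap ℂ[X] (RatFunc ℂ) p

/-- The uniformizer `t - c`. -/
noncomputable def unif (c : ℂ) : RatFunc ℂ := RatFunc.X - RatFunc.C c

theorem unif_eq (c : ℂ) : unif c = algebraMap ℂ[X] (RatFunc ℂ) (X - C c) := by
  simp [unif]

theorem unif_ne_zero (c : ℂ) : unif c ≠ 0 := by
  rw [unif_eq, Ne, FaithfulSMul.algebraMap_eq_zero_iff]; exact X_sub_C_ne_zero c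

theorem ratDeriv_unif (c : ℂ) : ratDeriv (unif c) = 1 := by
  rw [unif_eq, ratDeriv_algebraMap]; simp

namespace HasValueAt

variable {c a b : ℂ} {u v : RatFunc ℂ}

theorem congr' (hu : HasValueAt c a u) (h : a = b) : HasValueAt c b u := h ▸ hu

theorem add (hu : HasValueAt c a u) (hv : HasValueAt c b v) : HasValueAt c (a + b) (u + v) := by
  obtain ⟨p, q, hq, hp, h⟩ := hu
  obtain ⟨r, s, hs, hr, h'⟩ := hv
  refine ⟨p * s + r * q, q * s, by simp [hq, hs], by simp [hp, hr]; ring, ?_⟩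
  simp only [map_mul, map_add, ← h, ← h']; ring

theorem mul (hu : HasValueAt c a u) (hv : HasValueAt c b v) : HasValueAt c (a * b) (u * v) := by
  obtain ⟨p, q, hq, hp, h⟩ := hu
  obtain ⟨r, s, hs, hr, h'⟩ := hv
  refine ⟨p * r, q * s, by simp [hq, hs], by simp [hp, hr]; ring, ?_⟩
  simp only [map_mul, ← h, ← h']; ring

theorem poly (p : ℂ[X]) : HasValueAt c (p.eval c) (algebraMap ℂ[X] (RatFunc ℂ) p) :=
  ⟨p, 1, by simp, by simp, by simp⟩

theorem const (r : ℂ) : HasValueAt c r (RatFunc.C r) := by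
  simpa using poly (c := c) (C r)

theorem var : HasValueAt c c RatFunc.X := by
  simpa using poly (c := c) Polynomial.X

theorem unif_zero : HasValueAt c 0 (unif c) := by
  have h := poly (c := c) (Polynomial.X - C c)
  rwa [← unif_eq, eval_sub, eval_X, eval_C, sub_self] at h

theorem inv (hu : HasValueAt c a u) (ha : a ≠ 0) : HasValueAt c a⁻¹ u⁻¹ := by
  obtain ⟨p, q, hq, hp, h⟩ := hu
  have hp' : p.eval c ≠ 0 := by rw [hp]; exact mul_ne_zero ha hq
  refine ⟨q, p, hp', by rw [hp]; field_simp, ?_⟩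
  have hu : u ≠ 0 := by
    rintro rfl
    rw [zero_mul, eq_comm] at h
    have : p = 0 := by simpa using h
    simp [this] at hp'
  rw [← h]; field_simp

theorem deriv (hu : HasValueAt c a u) : ∃ b, HasValueAt c b (ratDeriv u) := by
  obtain ⟨p, q, hq, hp, h⟩ := hu
  refine ⟨(derivative p * q - p * derivative q).eval c / (q ^ 2).eval c,
    derivative p * q - p * derivative q, q ^ 2, by simp [hq], ?_, ratDeriv_eq_of_mul_eq h⟩
  rw [div_mul_cancel₀]; simp [hq]

theorem unique (hu : HasValueAt c a u) (hv : HasValueAt c b u) : a = b := by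
  obtain ⟨p, q, hq, hp, h⟩ := hu
  obtain ⟨r, s, hs, hr, h'⟩ := hv
  have : p * s = r * q := by
    apply RatFunc.algebraMap_injective ℂ
    simp only [map_mul, ← h, ← h']; ring
  have := congrArg (Polynomial.eval c) this
  simp only [eval_mul, hp, hr] at this
  apply mul_right_cancel₀ (mul_ne_zero hq hs)
  linear_combination this

theorem exists_eq_unif_mul (hu : HasValueAt c 0 u) :
    ∃ b v, HasValueAt c b v ∧ u = unif c * v := by
  obtain ⟨p, q, hq, hp, h⟩ := hu
  have hroot : p.IsRoot c := by simpa using hp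
  obtain ⟨r, rfl⟩ := dvd_iff_isRoot.2 hroot
  have hq0 : algebraMap ℂ[X] (RatFunc ℂ) q ≠ 0 := by
    have : q ≠ 0 := by rintro rfl; simp at hq
    simpa using this
  refine ⟨r.eval c / q.eval c, algebraMap ℂ[X] (RatFunc ℂ) r / algebraMap _ _ q,
    ⟨r, q, hq, by field_simp, by field_simp⟩, ?_⟩
  rw [unif_eq, ← mul_div_assoc, ← map_mul, ← h]
  field_simp

end HasValueAt

/-- The Laurent expansion of `f` at `c` starts with `a (t - c) ^ k`, where `a = 0` is allowed. -/
def LeadAt (c : ℂ) (k : ℤ) (a : ℂ) (f : RatFunc ℂ) : Prop :=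
  ∃ u, HasValueAt c a u ∧ f = unif c ^ k * u

namespace LeadAt

variable {c a b : ℂ} {k l : ℤ} {f g : RatFunc ℂ}

theorem congr (h : LeadAt c k a f) (hk : k = l) (ha : a = b) (hf : f = g) : LeadAt c l b g := by
  subst hk ha hf; exact h

theorem add (hf : LeadAt c k a f) (hg : LeadAt c k b g) : LeadAt c k (a + b) (f + g) := by
  obtain ⟨u, hu, rfl⟩ := hf
  obtain ⟨v, hv, rfl⟩ := hg
  exact ⟨u + v, hu.add hv, by ring⟩

theorem mul (hf : LeadAt c k a f) (hg : LeadAt c l b g) : LeadAt c (k + l) (a * b) (f * g) := by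
  obtain ⟨u, hu, rfl⟩ := hf
  obtain ⟨v, hv, rfl⟩ := hg
  exact ⟨u * v, hu.mul hv, by rw [zpow_add₀ (unif_ne_zero c)]; ring⟩

theorem const (r : ℂ) : LeadAt c 0 r (RatFunc.C r) := ⟨_, .const r, by simp⟩

theorem ofValue (h : HasValueAt c a f) : LeadAt c 0 a f := ⟨f, h, by simp⟩

theorem hasValue (h : LeadAt c 0 a f) : HasValueAt c a f := by
  obtain ⟨u, hu, rfl⟩ := h
  simpa using hu

theorem var : LeadAt c 0 c RatFunc.X := ofValue .var

theorem const_mul (r : ℂ) (hf : LeadAt c k a f) : LeadAt c k (r * a) (RatFunc.C r * f) :=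
  ((const r).mul hf).congr (zero_add k) rfl rfl

theorem neg (hf : LeadAt c k a f) : LeadAt c k (-a) (-f) :=
  (hf.const_mul (-1)).congr rfl (by ring) (by simp)

theorem sub (hf : LeadAt c k a f) (hg : LeadAt c k b g) : LeadAt c k (a - b) (f - g) :=
  (hf.add hg.neg).congr rfl (by ring) (by ring)

theorem two_mul (hf : LeadAt c k a f) : LeadAt c k (2 * a) (2 * f) :=
  (hf.add hf).congr rfl (by ring) (by ring)

theorem zero : LeadAt c k 0 0 := ⟨0, by simpa using HasValueAt.const (c := c) 0, by simp⟩

theorem zpow (k : ℤ) : LeadAt c k 1 (unif c ^ k) :=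
  ⟨1, by simpa using HasValueAt.const (c := c) 1, by simp⟩

theorem unique (hf : LeadAt c k a f) (hg : LeadAt c k b f) : a = b := by
  obtain ⟨u, hu, rfl⟩ := hf
  obtain ⟨v, hv, h⟩ := hg
  have := mul_left_cancel₀ (zpow_ne_zero k (unif_ne_zero c)) h
  subst this
  exact hu.unique hv

theorem lower (hf : LeadAt c k a f) (h : l < k) : LeadAt c l 0 f := by
  obtain ⟨u, hu, rfl⟩ := hf
  obtain ⟨n, hn⟩ := Int.eq_ofNat_of_zero_le (show 0 ≤ k - l - 1 by omega)
  have hpow : HasValueAt c (0 * (c - c) ^ n * a) (unif c * unif c ^ n * u) := by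
    refine (HasValueAt.unif_zero.mul ?_).mul hu
    have h := HasValueAt.poly (c := c) ((Polynomial.X - C c) ^ n)
    rwa [map_pow, ← unif_eq, eval_pow, eval_sub, eval_X, eval_C] at h
  refine ⟨unif c * unif c ^ n * u, by simpa using hpow, ?_⟩
  have : k = l + 1 + n := by omega
  rw [this, zpow_add₀ (unif_ne_zero c), zpow_add₀ (unif_ne_zero c)]
  simp; ring

theorem lower_le (hf : LeadAt c k a f) (h : l ≤ k) : ∃ b, LeadAt c l b f := by
  rcases h.lt_or_eq with h | rfl
  · exact ⟨0, hf.lower h⟩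
  · exact ⟨a, hf⟩

/-- The engine of every induction on orders: once a leading coefficient is shown to vanish, the
order improves by one. -/
theorem lift (hf : LeadAt c k 0 f) : ∃ b, LeadAt c (k + 1) b f := by
  obtain ⟨u, hu, rfl⟩ := hf
  obtain ⟨b, v, hv, rfl⟩ := hu.exists_eq_unif_mul
  exact ⟨b, v, hv, by rw [zpow_add_one₀ (unif_ne_zero c)]; ring⟩

theorem deriv (hf : LeadAt c k a f) : LeadAt c (k - 1) (k * a) (ratDeriv f) := by
  obtain ⟨u, hu, rfl⟩ := hf
  obtain ⟨b, hb⟩ := hu.deriv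
  refine ⟨RatFunc.C (k : ℂ) * u + unif c * ratDeriv u, ?_, ?_⟩
  · simpa using ((HasValueAt.const (c := c) k).mul hu).add (HasValueAt.unif_zero.mul hb)
  · rw [ratDeriv_mul, ratDeriv_zpow _ (unif_ne_zero c), ratDeriv_unif,
      zpow_sub_one₀ (unif_ne_zero c)]
    have := unif_ne_zero c
    simp only [map_intCast]
    field_simp
    ring

theorem inv (hf : LeadAt c k a f) (ha : a ≠ 0) : LeadAt c (-k) a⁻¹ f⁻¹ := by
  obtain ⟨u, hu, rfl⟩ := hf
  exact ⟨u⁻¹, hu.inv ha, by rw [zpow_neg, mul_inv]⟩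

theorem ne_zero (hf : LeadAt c k a f) (ha : a ≠ 0) : f ≠ 0 := by
  rintro rfl
  exact ha (hf.unique zero)

theorem of_mul (hf : LeadAt c k a f) (ha : a ≠ 0) (hfg : LeadAt c l b (f * g)) :
    LeadAt c (l - k) (b / a) g :=
  (hfg.mul (hf.inv ha)).congr (by ring) (by field_simp)
    (by have := hf.ne_zero ha; field_simp)

end LeadAt

theorem exists_leadAt (c : ℂ) {f : RatFunc ℂ} (hf : f ≠ 0) : ∃ k a, a ≠ 0 ∧ LeadAt c k a f := by
  have hpoly : ∀ p : ℂ[X], p ≠ 0 → ∃ k a, a ≠ 0 ∧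
      LeadAt c k a (algebraMap ℂ[X] (RatFunc ℂ) p) := by
    intro p hp
    obtain ⟨q, hq, hqc⟩ := exists_eq_pow_rootMultiplicity_mul_and_not_dvd p hp c
    refine ⟨p.rootMultiplicity c, q.eval c, ?_, algebraMap _ _ q, .poly q, ?_⟩
    · rwa [Ne, ← IsRoot.def, ← dvd_iff_isRoot]
    · conv_lhs => rw [hq]
      simp [unif_eq]
  obtain ⟨p, q, hq, h⟩ := exists_mul_eq f
  have hq' : algebraMap ℂ[X] (RatFunc ℂ) q ≠ 0 := by simpa using hq
  have hp : p ≠ 0 := by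
    rintro rfl
    simp [hf, hq] at h
  obtain ⟨k, a, ha, hk⟩ := hpoly p hp
  obtain ⟨l, b, hb, hl⟩ := hpoly q hq
  refine ⟨k - l, a / b, div_ne_zero ha hb, hl.of_mul hb (hk.congr rfl rfl ?_)⟩
  rw [← h, mul_comm]

theorem not_hasPoleAt_iff (c : ℂ) (f : RatFunc ℂ) : ¬ HasPoleAt f c ↔ ∃ a, LeadAt c 0 a f := by
  constructor
  · intro h
    refine ⟨f.num.eval c / f.denom.eval c, .ofValue ⟨f.num, f.denom, h, ?_, ?_⟩⟩
    · rw [div_mul_cancel₀]; exact h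
    · have hd' : algebraMap ℂ[X] (RatFunc ℂ) f.denom ≠ 0 := by simpa using f.denom_ne_zero
      exact (div_eq_iff hd').1 (RatFunc.num_div_denom f) |>.symm
  · rintro ⟨a, h⟩ hpole
    obtain ⟨p, q, hq, -, h⟩ := h.hasValue
    have hq0 : q ≠ 0 := by rintro rfl; simp at hq
    have : f.denom ∣ q := by
      rw [RatFunc.denom_dvd hq0]
      exact ⟨p, by rw [← h]; field_simp [show algebraMap ℂ[X] (RatFunc ℂ) q ≠ 0 by simpa using hq0]⟩
    exact hq (eval_eq_zero_of_dvd_of_eval_eq_zero this hpole)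

/-! ### Indices modulo six. -/

theorem sum_zmod_six {M : Type*} [AddCommMonoid M] (g : ZMod 6 → M) :
    ∑ i, g i = g 0 + g 1 + g 2 + g 3 + g 4 + g 5 :=
  Fin.sum_univ_six g

theorem forall_zmod_six {p : ZMod 6 → Prop} (h0 : p 0) (h1 : p 1) (h2 : p 2) (h3 : p 3) (h4 : p 4)
    (h5 : p 5) (i : ZMod 6) : p i := by
  fin_cases i
  exacts [h0, h1, h2, h3, h4, h5]

theorem zmod_six_add :
    ((1 + 1 : ZMod 6) = 2 ∧ (1 + 2 : ZMod 6) = 3 ∧ (1 + 3 : ZMod 6) = 4 ∧ (1 + 4 : ZMod 6) = 5 ∧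
      (1 + 5 : ZMod 6) = 0) ∧
    ((2 + 1 : ZMod 6) = 3 ∧ (2 + 2 : ZMod 6) = 4 ∧ (2 + 3 : ZMod 6) = 5 ∧ (2 + 4 : ZMod 6) = 0 ∧
      (2 + 5 : ZMod 6) = 1) ∧
    ((3 + 1 : ZMod 6) = 4 ∧ (3 + 2 : ZMod 6) = 5 ∧ (3 + 3 : ZMod 6) = 0 ∧ (3 + 4 : ZMod 6) = 1 ∧
      (3 + 5 : ZMod 6) = 2) ∧
    ((4 + 1 : ZMod 6) = 5 ∧ (4 + 2 : ZMod 6) = 0 ∧ (4 + 3 : ZMod 6) = 1 ∧ (4 + 4 : ZMod 6) = 2 ∧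
      (4 + 5 : ZMod 6) = 3) ∧
    ((5 + 1 : ZMod 6) = 0 ∧ (5 + 2 : ZMod 6) = 1 ∧ (5 + 3 : ZMod 6) = 2 ∧ (5 + 4 : ZMod 6) = 3 ∧
      (5 + 5 : ZMod 6) = 4) := by
  decide

/-! ### Elimination of high order poles -/

/-- The cubic part of the `i`-th equation, divided by `f i`, when `f i + f (i + 2) + f (i + 4)`
equals `T` for all `i`. -/
noncomputable def coupling (T : RatFunc ℂ) (f : ZMod 6 → RatFunc ℂ) (i : ZMod 6) : RatFunc ℂ :=
  f (i + 2) * (2 * f (i + 1) - T) - f (i + 4) * (2 * f (i + 5) - T)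

theorem coupling_comp_add (T : RatFunc ℂ) (f : ZMod 6 → RatFunc ℂ) (s i : ZMod 6) :
    coupling T (fun j => f (j + s)) i = coupling T f (i + s) := by
  simp only [coupling, add_right_comm]

/-- In the sum of the couplings at `i` and `i + 3` the quadratic terms cancel, leaving `T` times a
linear form. Opposite equations thus give information one pole order beyond their leading terms. -/
theorem mul_add_coupling (T : RatFunc ℂ) (f : ZMod 6 → RatFunc ℂ) (i : ZMod 6) :
    f i * f (i + 3) * T * (f (i + 1) + f (i + 4) - (f (i + 2) + f (i + 5))) =
      f (i + 3) * (f i * coupling T f i) + f i * (f (i + 3) * coupling T f (i + 3)) := by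
  have h1 : i + 3 + 2 = i + 5 := by rw [add_assoc]; rfl
  have h2 : i + 3 + 1 = i + 4 := by rw [add_assoc]; rfl
  have h3 : i + 3 + 4 = i + 1 := by rw [add_assoc]; rfl
  have h4 : i + 3 + 5 = i + 2 := by rw [add_assoc]; rfl
  simp only [coupling, h1, h2, h3, h4]
  ring

/-- A system `f i * coupling T f i = (smaller terms)` near the point `c`. -/
structure LocalSystem (c τ : ℂ) (r : ℤ) (T : RatFunc ℂ) (f : ZMod 6 → RatFunc ℂ) : Prop where
  lead : LeadAt c 0 τ T
  ne_zero : τ ≠ 0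
  sum : ∀ i, f i + f (i + 2) + f (i + 4) = T
  bound : ∀ i k b, LeadAt c k b (f i) →
    ∃ b', LeadAt c (min k r - r) b' (f i * coupling T f i)

namespace LocalSystem

variable {c τ : ℂ} {r e : ℤ} {T : RatFunc ℂ} {f : ZMod 6 → RatFunc ℂ} {a : ZMod 6 → ℂ}

theorem rotate (h : LocalSystem c τ r T f) (s : ZMod 6) :
    LocalSystem c τ r T (fun i => f (i + s)) where
  lead := h.lead
  ne_zero := h.ne_zero
  sum i := by simpa only [add_right_comm] using h.sum (i + s)
  bound i k b hk := by simpa only [coupling_comp_add] using h.bound (i + s) k b hk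

theorem sum_lead (h : LocalSystem c τ r T f) (he : 1 ≤ e) (ha : ∀ i, LeadAt c (-e) (a i) (f i))
    (i : ZMod 6) : a i + a (i + 2) + a (i + 4) = 0 :=
  (((ha i).add (ha (i + 2))).add (ha (i + 4))).unique
    ((h.lead.lower (by omega)).congr rfl rfl (h.sum i).symm)

theorem two_mul_sub_lead (h : LocalSystem c τ r T f) (he : 1 ≤ e)
    (ha : ∀ i, LeadAt c (-e) (a i) (f i)) (i : ZMod 6) :
    LeadAt c (-e) (2 * a i) (2 * f i - T) :=
  ((ha i).two_mul.sub (h.lead.lower (by omega))).congr rfl (by ring) rfl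

theorem coupling_lead (h : LocalSystem c τ r T f) (he : 1 ≤ e)
    (ha : ∀ i, LeadAt c (-e) (a i) (f i)) (i : ZMod 6) :
    LeadAt c (-e + -e) (a (i + 2) * (2 * a (i + 1)) - a (i + 4) * (2 * a (i + 5)))
      (coupling T f i) :=
  ((ha _).mul (h.two_mul_sub_lead he ha _)).sub ((ha _).mul (h.two_mul_sub_lead he ha _))

theorem cubic_lead (h : LocalSystem c τ r T f) (he : 1 ≤ e) (hr : r < 2 * e)
    (ha : ∀ i, LeadAt c (-e) (a i) (f i)) (i : ZMod 6) :
    a i * (a (i + 2) * (2 * a (i + 1)) - a (i + 4) * (2 * a (i + 5))) = 0 := by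
  obtain ⟨b, hb⟩ := h.bound i _ _ (ha i)
  exact ((ha i).mul (h.coupling_lead he ha i)).unique (hb.lower (by omega))

theorem exists_large_order (_ : LocalSystem c τ r T f) {i : ZMod 6}
    (hi : ¬ ∃ b, LeadAt c e b (f i)) : ∃ k b, k < e ∧ b ≠ 0 ∧ LeadAt c k b (f i) := by
  have h0 : f i ≠ 0 := fun h0 => hi ⟨0, by rw [h0]; exact LeadAt.zero⟩
  obtain ⟨k, b, hb, hk⟩ := exists_leadAt c h0
  refine ⟨k, b, ?_, hb, hk⟩
  by_contra! hle
  exact hi (hk.lower_le hle)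

/-- If `f (i + 3)` and its two companions have lower pole order than the others and `f (i + 3)` is
not too small, then the leading coefficients of the two companions of `f i` agree. -/
theorem lead_eq_of_large (h : LocalSystem c τ r T f) (he : 1 ≤ e) (hr : r < e)
    (ha : ∀ i, LeadAt c (-e) (a i) (f i)) {i : ZMod 6} (h1 : a (i + 1) = 0) (h5 : a (i + 5) = 0)
    (hi : ¬ ∃ b, LeadAt c e b (f (i + 3))) (hai : a i ≠ 0) : a (i + 4) = a (i + 2) := by
  obtain ⟨k, b, hke, hb, hk⟩ := h.exists_large_order hi
  have hD := ((ha (i + 1)).add (ha (i + 4))).sub ((ha (i + 2)).add (ha (i + 5)))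
  have hL := (((ha i).mul hk).mul h.lead).mul hD
  rw [mul_add_coupling] at hL
  obtain ⟨b1, hb1⟩ := h.bound i _ _ (ha i)
  obtain ⟨b2, hb2⟩ := h.bound (i + 3) _ _ hk
  -- Both products have order above `k - 2 * e`. For the first this is `r < e`; for the second, `k <
  -- e` is also needed when `k ≥ r`.
  have hR := ((hk.mul hb1).lower (l := -e + k + 0 + -e) (by omega)).add
    (((ha i).mul hb2).lower (l := -e + k + 0 + -e) (by omega))
  have := hL.unique hR
  rw [h1, h5, add_zero, add_zero, zero_add] at this
  simp only [mul_eq_zero, hai, hb, h.ne_zero, or_self, false_or] at this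
  linear_combination this

/-- If one parity class has pole order `e` and two elements of the other vanish, then all leading
coefficients vanish. -/
theorem lead_eq_zero_of_small (h : LocalSystem c τ r T f) (he : 1 ≤ e) (hr : r < e)
    (ha : ∀ i, LeadAt c (-e) (a i) (f i))
    (h1 : ∃ b, LeadAt c e b (f 1)) (h5 : ∃ b, LeadAt c e b (f 5)) :
    a 0 = 0 ∧ a 2 = 0 ∧ a 4 = 0 := by
  obtain ⟨b1, hb1⟩ := h1
  obtain ⟨b5, hb5⟩ := h5
  have l1 := hb1.lower (l := 0) (by omega)
  have l5 := hb5.lower (l := 0) (by omega)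
  have l3 : LeadAt c 0 τ (f 3) := ((h.lead.sub l1).sub l5).congr rfl (by ring) (by
    have : f 1 + f 3 + f 5 = T := h.sum 1
    rw [← this]; ring)
  have hs : a 0 + a 2 + a 4 = 0 := h.sum_lead he ha 0
  have m1 : LeadAt c 0 (-τ) (2 * f 1 - T) := (l1.two_mul.sub h.lead).congr rfl (by ring) rfl
  have m3 : LeadAt c 0 τ (2 * f 3 - T) := (l3.two_mul.sub h.lead).congr rfl (by ring) rfl
  have m5 : LeadAt c 0 (-τ) (2 * f 5 - T) := (l5.two_mul.sub h.lead).congr rfl (by ring) rfl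
  have e0 : a 0 * (a 2 * -τ - a 4 * -τ) = 0 := by
    obtain ⟨b, hb⟩ := h.bound 0 _ _ (ha 0)
    exact ((ha 0).mul (((ha 2).mul m1).sub ((ha 4).mul m5))).unique
      (hb.lower (l := -e + (-e + 0)) (by omega))
  have e2 : a 2 * (a 4 * τ - a 0 * -τ) = 0 := by
    obtain ⟨b, hb⟩ := h.bound 2 _ _ (ha 2)
    exact ((ha 2).mul (((ha 4).mul m3).sub ((ha 0).mul m1))).unique
      (hb.lower (l := -e + (-e + 0)) (by omega))
  have e4 : a 4 * (a 0 * -τ - a 2 * τ) = 0 := by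
    obtain ⟨b, hb⟩ := h.bound 4 _ _ (ha 4)
    exact ((ha 4).mul (((ha 0).mul m5).sub ((ha 2).mul m3))).unique
      (hb.lower (l := -e + (-e + 0)) (by omega))
  have hτ := h.ne_zero
  have h2 : a 2 = 0 := by
    have : a 2 * a 2 * τ = 0 := by linear_combination a 2 * τ * hs - e2
    simpa [hτ] using this
  have h4 : a 4 = 0 := by
    have : a 4 * a 4 * τ = 0 := by linear_combination a 4 * τ * hs + e4
    simpa [hτ] using this
  exact ⟨by linear_combination hs - h2 - h4, h2, h4⟩

/-- Among `f 1`, `f 3`, `f 5` either two have order at least `e`, and `lead_eq_zero_of_small`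
applies, or two do not. In the latter case `lead_eq_of_large` gives two relations among `a 0`, `a
2`, `a 4`, which together with the zero sum force all three to vanish. -/
theorem lead_eq_zero_of_odd (h : LocalSystem c τ r T f) (he : 1 ≤ e) (hr : r < e)
    (ha : ∀ i, LeadAt c (-e) (a i) (f i)) (h1 : a 1 = 0) (h3 : a 3 = 0) (h5 : a 5 = 0) :
    a 0 = 0 ∧ a 2 = 0 ∧ a 4 = 0 := by
  have hs : a 0 + a 2 + a 4 = 0 := h.sum_lead he ha 0
  have l1 : (¬ ∃ b, LeadAt c e b (f 1)) → a 4 ≠ 0 → a 2 = a 0 := fun hi hai =>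
    h.lead_eq_of_large he hr ha (i := 4) h5 h3 hi hai
  have l3 : (¬ ∃ b, LeadAt c e b (f 3)) → a 0 ≠ 0 → a 4 = a 2 := fun hi hai =>
    h.lead_eq_of_large he hr ha (i := 0) h1 h5 hi hai
  have l5 : (¬ ∃ b, LeadAt c e b (f 5)) → a 2 ≠ 0 → a 0 = a 4 := fun hi hai =>
    h.lead_eq_of_large he hr ha (i := 2) h3 h1 hi hai
  have s5 : (∃ b, LeadAt c e b (f 1)) → (∃ b, LeadAt c e b (f 5)) → a 0 = 0 ∧ a 2 = 0 ∧ a 4 = 0 :=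
    h.lead_eq_zero_of_small he hr ha
  have s1 : (∃ b, LeadAt c e b (f 3)) → (∃ b, LeadAt c e b (f 1)) → a 2 = 0 ∧ a 4 = 0 ∧ a 0 = 0 :=
    (h.rotate 2).lead_eq_zero_of_small he hr (fun i => ha (i + 2))
  have s3 : (∃ b, LeadAt c e b (f 5)) → (∃ b, LeadAt c e b (f 3)) → a 4 = 0 ∧ a 0 = 0 ∧ a 2 = 0 :=
    (h.rotate 4).lead_eq_zero_of_small he hr (fun i => ha (i + 4))
  generalize (∃ b, LeadAt c e b (f 1)) = p1 at *
  generalize (∃ b, LeadAt c e b (f 3)) = p3 at *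
  generalize (∃ b, LeadAt c e b (f 5)) = p5 at *
  clear ha h
  by_cases q1 : p1 <;> by_cases q3 : p3 <;> by_cases q5 : p5 <;> by_cases h0 : a 0 = 0 <;> by_cases h2 : a 2 = 0 <;>
    by_cases h4 : a 4 = 0 <;> grind

theorem product_lead (h : LocalSystem c τ r T f) (he : 1 ≤ e) (hr : r < e)
    (ha : ∀ i, LeadAt c (-e) (a i) (f i)) (i : ZMod 6) :
    a i * a (i + 3) * (a (i + 1) + a (i + 4) - (a (i + 2) + a (i + 5))) = 0 := by
  have hD := ((ha (i + 1)).add (ha (i + 4))).sub ((ha (i + 2)).add (ha (i + 5)))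
  have hL := (((ha i).mul (ha (i + 3))).mul h.lead).mul hD
  rw [mul_add_coupling] at hL
  obtain ⟨b1, hb1⟩ := h.bound i _ _ (ha i)
  obtain ⟨b2, hb2⟩ := h.bound (i + 3) _ _ (ha (i + 3))
  have hR := (((ha (i + 3)).mul hb1).lower (l := -e + -e + 0 + -e) (by omega)).add
    (((ha i).mul hb2).lower (l := -e + -e + 0 + -e) (by omega))
  have := hL.unique hR
  have hτ := h.ne_zero
  have h2 : τ * (a i * a (i + 3) * (a (i + 1) + a (i + 4) - (a (i + 2) + a (i + 5)))) = 0 := by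
    linear_combination this
  simpa [hτ] using h2

end LocalSystem

/-- The brackets are twice the 2×2 minors of `(a0, a2, a4)` and `(a3, a5, a1)`. Both vectors have
zero sum, so the vanishing of one minor already makes them parallel. -/
theorem parallel_or_zero {a0 a1 a2 a3 a4 a5 : ℂ} (hs : a0 + a2 + a4 = 0) (hs' : a1 + a3 + a5 = 0)
    (e0 : a0 * (a2 * (2 * a1) - a4 * (2 * a5)) = 0)
    (e2 : a2 * (a4 * (2 * a3) - a0 * (2 * a1)) = 0) :
    (a0 = 0 ∧ a2 = 0 ∧ a4 = 0) ∨ (a1 = 0 ∧ a3 = 0 ∧ a5 = 0) ∨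
      ∃ κ : ℂ, κ ≠ 0 ∧ a3 = κ * a0 ∧ a5 = κ * a2 ∧ a1 = κ * a4 := by
  rw [or_iff_not_imp_left, or_iff_not_imp_left]
  intro h1 h2
  by_cases h0 : a0 = 0
  · have h2' : a2 ≠ 0 := by grind
    refine ⟨a5 / a2, by grind, by grind, by grind, by grind⟩
  · refine ⟨a3 / a0, ?_, by field_simp, ?_, ?_⟩
    · by_cases a2 = 0 <;> by_cases a4 = 0 <;> grind
    · by_cases a2 = 0 <;> by_cases a4 = 0 <;> grind
    · by_cases a2 = 0 <;> by_cases a4 = 0 <;> grind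

/-- In the parallel case with ratio `κ`, `product_lead` becomes `κ * (1 + κ) * a0 ^ 2 * (a4 - a2) =
0` and its rotations. Unless `κ = -1`, these and the zero sum kill everything. -/
theorem LocalSystem.opposite {c τ : ℂ} {r e : ℤ} {T : RatFunc ℂ} {f : ZMod 6 → RatFunc ℂ}
    {a : ZMod 6 → ℂ} (h : LocalSystem c τ r T f) (he : 1 ≤ e) (hr : r < e)
    (ha : ∀ i, LeadAt c (-e) (a i) (f i)) : a 3 = -a 0 ∧ a 5 = -a 2 ∧ a 1 = -a 4 := by
  have hs : a 0 + a 2 + a 4 = 0 := h.sum_lead he ha 0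
  have hs' : a 1 + a 3 + a 5 = 0 := h.sum_lead he ha 1
  have hodd : a 1 = 0 → a 3 = 0 → a 5 = 0 → a 0 = 0 ∧ a 2 = 0 ∧ a 4 = 0 :=
    h.lead_eq_zero_of_odd he hr ha
  have heven : a 2 = 0 → a 4 = 0 → a 0 = 0 → a 1 = 0 ∧ a 3 = 0 ∧ a 5 = 0 :=
    (h.rotate 1).lead_eq_zero_of_odd he hr (fun i => ha (i + 1))
  have p0 : a 0 * a 3 * (a 1 + a 4 - (a 2 + a 5)) = 0 := h.product_lead he hr ha 0
  have p2 : a 2 * a 5 * (a 3 + a 0 - (a 4 + a 1)) = 0 := h.product_lead he hr ha 2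
  have p4 : a 4 * a 1 * (a 5 + a 2 - (a 0 + a 3)) = 0 := h.product_lead he hr ha 4
  rcases parallel_or_zero hs hs' (h.cubic_lead he (by omega) ha 0)
    (h.cubic_lead he (by omega) ha 2) with ⟨h0, h2, h4⟩ | ⟨h1, h3, h5⟩ | ⟨κ, hκ, h3, h5, h1⟩
  · obtain ⟨h1, h3, h5⟩ := heven h2 h4 h0
    simp [h0, h1, h2, h3, h4, h5]
  · obtain ⟨h0, h2, h4⟩ := hodd h1 h3 h5
    simp [h0, h1, h2, h3, h4, h5]
  · rw [h3, h5, h1]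
    rw [h3, h1, h5] at p0 p2 p4
    clear hodd heven h ha
    generalize a 0 = a0 at *
    generalize a 2 = a2 at *
    generalize a 4 = a4 at *
    by_cases hκ' : κ = -1
    · subst hκ'; simp
    · have hne : 1 + κ ≠ 0 := fun h => hκ' (by linear_combination h)
      have q0 : a0 * (a4 - a2) = 0 := by
        have : (a0 * (a4 - a2)) * a0 * κ * (1 + κ) = 0 := by linear_combination p0
        simp only [mul_eq_zero, hκ, hne, or_false] at this ⊢
        tauto
      have q2 : a2 * (a0 - a4) = 0 := by
        have : (a2 * (a0 - a4)) * a2 * κ * (1 + κ) = 0 := by linear_combination p2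
        simp only [mul_eq_zero, hκ, hne, or_false] at this ⊢
        tauto
      have q4 : a4 * (a2 - a0) = 0 := by
        have : (a4 * (a2 - a0)) * a4 * κ * (1 + κ) = 0 := by linear_combination p4
        simp only [mul_eq_zero, hκ, hne, or_false] at this ⊢
        tauto
      have h0 : a0 = 0 := by grind
      have h2 : a2 = 0 := by grind
      have h4 : a4 = 0 := by grind
      simp [h0, h2, h4]

namespace LocalSystem

variable {c τ : ℂ} {r e : ℤ} {T : RatFunc ℂ} {f : ZMod 6 → RatFunc ℂ} {a : ZMod 6 → ℂ}

/-- Rewriting through the sums `f i + f (i + 3)` pays off because their leading terms cancel by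
`opposite`. -/
theorem coupling_zero_eq (h : LocalSystem c τ r T f) : coupling T f 0 =
    -(2 * f 4 * (T - (f 0 + f 3))) + (T - f 0) * (2 * (f 1 + f 4) - T) := by
  have h0 : f 0 + f 2 + f 4 = T := h.sum 0
  have h1 : f 1 + f 3 + f 5 = T := h.sum 1
  have hc : coupling T f 0 = f 2 * (2 * f 1 - T) - f 4 * (2 * f 5 - T) := rfl
  rw [hc]
  linear_combination (2 * f 1 - T) * h0 - 2 * f 4 * h1

theorem coupling_two_eq (T : RatFunc ℂ) (f : ZMod 6 → RatFunc ℂ) : coupling T f 2 =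
    f 4 * (2 * (f 0 + f 3) - T) - f 0 * (2 * (f 1 + f 4) - T) := by
  have hc : coupling T f 2 = f 4 * (2 * f 3 - T) - f 0 * (2 * f 1 - T) := rfl
  rw [hc]
  ring

/-- The differences of the sums `f i + f (i + 3)` have strictly smaller poles than expected. -/
theorem diff_lead (h : LocalSystem c τ r T f) {i : ZMod 6} {l : ℤ} {b b' : ℂ}
    (ha : ∀ i, LeadAt c (-e) (a i) (f i)) (hop : a (i + 3) = -a i) (hai : a i ≠ 0)
    (h1 : LeadAt c l b (f i * coupling T f i))
    (h2 : LeadAt c l b' (f (i + 3) * coupling T f (i + 3))) :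
    LeadAt c (l + e) ((b' - b) / (-a i * τ))
      (f (i + 1) + f (i + 4) - (f (i + 2) + f (i + 5))) := by
  have hff := ((ha i).mul (ha (i + 3))).mul h.lead
  have hne : a i * a (i + 3) * τ ≠ 0 := by
    rw [hop]; simp [hai, h.ne_zero]
  have hR : LeadAt c (-e + l) (a (i + 3) * b + a i * b') (f i * f (i + 3) * T *
      (f (i + 1) + f (i + 4) - (f (i + 2) + f (i + 5)))) :=
    (((ha (i + 3)).mul h1).add ((ha i).mul h2)).congr rfl rfl (mul_add_coupling T f i).symm
  refine (hff.of_mul hne hR).congr (by ring) ?_ rfl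
  have := h.ne_zero
  rw [hop]
  field_simp
  ring

/-- If the right hand sides are small (as at infinity), then there is no pole at all. -/
theorem lead_eq_zero_of_neg_one (h : LocalSystem c τ (-1) T f) (he : 1 ≤ e)
    (ha : ∀ i, LeadAt c (-e) (a i) (f i)) : a 0 = 0 ∧ a 2 = 0 ∧ a 4 = 0 := by
  obtain ⟨o3, o5, o1⟩ := h.opposite he (by omega) ha
  have hs : a 0 + a 2 + a 4 = 0 := h.sum_lead he ha 0
  have hE : ∀ i, ∃ b, LeadAt c (-e + 1) b (f i * coupling T f i) := fun i => by
    obtain ⟨b, hb⟩ := h.bound i _ _ (ha i)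
    exact ⟨b, hb.congr (by omega) rfl rfl⟩
  choose E hE using hE
  have hdiff : ∀ i, a (i + 3) = -a i → a i ≠ 0 →
      LeadAt c 0 0 (f (i + 1) + f (i + 4) - (f (i + 2) + f (i + 5))) := fun i hop hai =>
    (h.diff_lead ha hop hai (hE i) (hE (i + 3))).lower (by omega)
  have D0 : a 0 ≠ 0 → LeadAt c 0 0 (f 1 + f 4 - (f 2 + f 5)) := hdiff 0 o3
  have D2 : a 2 ≠ 0 → LeadAt c 0 0 (f 3 + f 0 - (f 4 + f 1)) := hdiff 2 o5
  have D4 : a 4 ≠ 0 → LeadAt c 0 0 (f 5 + f 2 - (f 0 + f 3)) := hdiff 4 (by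
    show a 1 = - a 4; exact o1)
  have e0 : f 0 + f 2 + f 4 = T := h.sum 0
  have e1 : f 1 + f 3 + f 5 = T := h.sum 1
  -- The three sums `f i + f (i + 3)` add up to `2 * T`, so if their differences vanish at `c`, each
  -- takes the value `2 / 3 * τ`.
  have hd : (LeadAt c 0 0 (f 3 + f 0 - (f 4 + f 1)) ∧ LeadAt c 0 0 (f 5 + f 2 - (f 0 + f 3)) ∧
      LeadAt c 0 0 (f 1 + f 4 - (f 2 + f 5))) →
      LeadAt c 0 (2 / 3 * τ) (f 0 + f 3) ∧ LeadAt c 0 (2 / 3 * τ) (f 1 + f 4) ∧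
      LeadAt c 0 (2 / 3 * τ) (f 2 + f 5) := by
    rintro ⟨h2, h4, h0⟩
    have h3 : (RatFunc.C (1 / 3) : RatFunc ℂ) * 3 = 1 := by
      rw [← map_ofNat (RatFunc.C (K := ℂ)), ← map_mul]; norm_num
    refine ⟨((h.lead.two_mul.add (h2.sub h4)).const_mul (1 / 3)).congr rfl (by ring) ?_,
      ((h.lead.two_mul.add (h0.sub h2)).const_mul (1 / 3)).congr rfl (by ring) ?_,
      ((h.lead.two_mul.add (h4.sub h0)).const_mul (1 / 3)).congr rfl (by ring) ?_⟩
    · linear_combination (f 0 + f 3) * h3 - RatFunc.C (1 / 3) * (e0 + e1)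
    · linear_combination (f 1 + f 4) * h3 - RatFunc.C (1 / 3) * (e0 + e1)
    · linear_combination (f 2 + f 5) * h3 - RatFunc.C (1 / 3) * (e0 + e1)
  -- By the zero sum, at least two of the coefficients are nonzero. This controls two of the
  -- differences, and the third is minus their sum.
  have hd' : a 0 ≠ 0 ∨ a 2 ≠ 0 ∨ a 4 ≠ 0 →
      (LeadAt c 0 0 (f 3 + f 0 - (f 4 + f 1)) ∧ LeadAt c 0 0 (f 5 + f 2 - (f 0 + f 3)) ∧
      LeadAt c 0 0 (f 1 + f 4 - (f 2 + f 5))) := by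
    intro hne
    have c1 := fun x y => ((D0 x).add (D2 y)).neg.congr (b := 0) rfl (by ring)
      (show _ = f 5 + f 2 - (f 0 + f 3) by ring)
    have c2 := fun x y => ((D2 x).add (D4 y)).neg.congr (b := 0) rfl (by ring)
      (show _ = f 1 + f 4 - (f 2 + f 5) by ring)
    have c3 := fun x y => ((D0 x).add (D4 y)).neg.congr (b := 0) rfl (by ring)
      (show _ = f 3 + f 0 - (f 4 + f 1) by ring)
    by_cases z0 : a 0 = 0
    · have z2 : a 2 ≠ 0 := fun z2 => by grind
      have z4 : a 4 ≠ 0 := fun z4 => by grind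
      exact ⟨D2 z2, D4 z4, c2 z2 z4⟩
    · by_cases z2 : a 2 = 0
      · have z4 : a 4 ≠ 0 := fun z4 => by grind
        exact ⟨c3 z0 z4, D4 z4, D0 z0⟩
      · exact ⟨D2 z2, c1 z0 z2, D0 z0⟩
  by_contra hcon
  obtain ⟨d0, d1, d2⟩ := hd (hd' (by tauto))
  have m0 : LeadAt c 0 (τ / 3) (2 * (f 0 + f 3) - T) :=
    (d0.two_mul.sub h.lead).congr rfl (by ring) rfl
  have m1 : LeadAt c 0 (τ / 3) (2 * (f 1 + f 4) - T) :=
    (d1.two_mul.sub h.lead).congr rfl (by ring) rfl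
  have m2 : LeadAt c 0 (τ / 3) (2 * (f 2 + f 5) - T) :=
    (d2.two_mul.sub h.lead).congr rfl (by ring) rfl
  have hcoup : ∀ i, a i ≠ 0 → LeadAt c (-e + 0) 0 (coupling T f i) := fun i hi =>
    ((ha i).of_mul hi (hE i)).lower (by omega)
  have hτ := h.ne_zero
  have q2 : a 2 ≠ 0 → a 4 = a 0 := fun hi => by
    have := (((ha 4).mul m0).sub ((ha 0).mul m1)).unique
      ((hcoup 2 hi).congr rfl rfl (coupling_two_eq T f))
    have : τ * (a 4 - a 0) = 0 := by linear_combination 3 * this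
    simp only [mul_eq_zero, hτ, false_or] at this
    linear_combination this
  have q4 : a 4 ≠ 0 → a 0 = a 2 := fun hi => by
    have := (((ha 0).mul m2).sub ((ha 2).mul m0)).unique
      ((hcoup 4 hi).congr rfl rfl ?_)
    · have : τ * (a 0 - a 2) = 0 := by linear_combination 3 * this
      simp only [mul_eq_zero, hτ, false_or] at this
      linear_combination this
    · show f 0 * (2 * f 5 - T) - f 2 * (2 * f 3 - T) = _
      ring
  have q0 : a 0 ≠ 0 → a 2 = a 4 := fun hi => by
    have := (((ha 2).mul m1).sub ((ha 4).mul m2)).unique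
      ((hcoup 0 hi).congr rfl rfl ?_)
    · have : τ * (a 2 - a 4) = 0 := by linear_combination 3 * this
      simp only [mul_eq_zero, hτ, false_or] at this
      linear_combination this
    · show f 2 * (2 * f 1 - T) - f 4 * (2 * f 5 - T) = _
      ring
  clear hcoup hd hd' D0 D2 D4 d0 d1 d2 m0 m1 m2 hE hdiff h ha
  apply hcon
  by_cases z0 : a 0 = 0 <;> by_cases z2 : a 2 = 0 <;> by_cases z4 : a 4 = 0 <;> grind

/-- The core of the exclusion of poles of order at least two at a finite nonzero point. -/
theorem false_of_high_order {ℓ : ℂ} (h : LocalSystem c (2 * ℓ) 1 T f) (he : 2 ≤ e)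
    (ha : ∀ i, LeadAt c (-e) (a i) (f i))
    (hE : ∀ i, LeadAt c (-e - 1) (-(ℓ * e * a i)) (f i * coupling T f i))
    (h0 : a 0 = 0) (h2 : a 2 ≠ 0) : False := by
  obtain ⟨o3, o5, o1⟩ := h.opposite (by omega) (by omega) ha
  have hs : a 0 + a 2 + a 4 = 0 := h.sum_lead (by omega) ha 0
  have h4 : a 4 ≠ 0 := fun h4 => h2 (by linear_combination hs - h0 - h4)
  have hℓ : ℓ ≠ 0 := by simpa using h.ne_zero
  have e0 : f 0 + f 2 + f 4 = T := h.sum 0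
  have e1 : f 1 + f 3 + f 5 = T := h.sum 1
  have hdiff : ∀ i, a (i + 3) = -a i → a i ≠ 0 →
      LeadAt c (-1) (-e) (f (i + 1) + f (i + 4) - (f (i + 2) + f (i + 5))) := fun i hop hai =>
    (h.diff_lead ha hop hai (hE i) (hE (i + 3))).congr (by ring) (by rw [hop]; field_simp; ring) rfl
  have D2 : LeadAt c (-1) (-e) (f 3 + f 0 - (f 4 + f 1)) := hdiff 2 o5 h2
  have D4 : LeadAt c (-1) (-e) (f 5 + f 2 - (f 0 + f 3)) := hdiff 4 o1 h4
  have h3 : (RatFunc.C (1 / 3) : RatFunc ℂ) * 3 = 1 := by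
    rw [← map_ofNat (RatFunc.C (K := ℂ)), ← map_mul]; norm_num
  -- `3 * (f 0 + f 3)` is `2 * T` plus the difference of the functions in `D2` and `D4`. These have
  -- the same coefficient `-e`, so the simple pole cancels.
  obtain ⟨δ, hδ⟩ : ∃ δ, LeadAt c 0 δ (f 0 + f 3) :=
    (((h.lead.two_mul.lower (l := -1) (by omega)).add (D2.sub D4)).const_mul (1 / 3)).congr rfl
      (by ring) (by linear_combination (f 0 + f 3) * h3 - RatFunc.C (1 / 3) * (e0 + e1)) |>.lift
  have d1 : LeadAt c (-1) (2 * e) (2 * (f 1 + f 4) - T) :=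
    (((hδ.lower (l := -1) (by omega)).sub D2).two_mul.sub
      (h.lead.lower (l := -1) (by omega))).congr rfl (by ring) (by ring)
  obtain ⟨β, hβ⟩ : ∃ β, LeadAt c (-e + 1) β (f 0) := ((ha 0).congr rfl h0 rfl).lift
  obtain ⟨β', hβ'⟩ : ∃ β', LeadAt c (-e + 1) β' (f 3) :=
    ((ha 3).congr rfl (by rw [o3, h0, neg_zero]) rfl).lift
  have m0 : LeadAt c 0 (2 * δ - 2 * ℓ) (2 * (f 0 + f 3) - T) := hδ.two_mul.sub h.lead
  -- the equation with index `2`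
  have r2 : a 4 * (2 * δ - 2 * ℓ) - β * (2 * e) = 0 := by
    refine ((((ha 4).mul m0).congr (l := -e) (by ring) rfl rfl).sub
      ((hβ.mul d1).congr (by ring) rfl rfl)).unique ?_
    exact (((ha 2).of_mul h2 (hE 2)).congr rfl rfl (coupling_two_eq T f)).lower (by omega)
  have r5 : a 1 * (2 * δ - 2 * ℓ) - β' * (2 * e) = 0 := by
    refine ((((ha 1).mul m0).congr (l := -e) (by ring) rfl rfl).sub
      ((hβ'.mul d1).congr (by ring) rfl rfl)).unique ?_
    have : a 5 ≠ 0 := by rw [o5]; simpa using h2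
    refine (((ha 5).of_mul this (hE 5)).congr rfl rfl ?_).lower (by omega)
    show f 1 * (2 * f 0 - T) - f 3 * (2 * f 4 - T) = _
    ring
  -- the equations with indices `0` and `3`
  have c0 : LeadAt c (-e) (-(2 * a 4 * (2 * ℓ - δ)) - β * (2 * e)) (coupling T f 0) := by
    rw [h.coupling_zero_eq]
    refine ((((ha 4).two_mul.mul (h.lead.sub hδ)).congr (l := -e) (by ring) rfl rfl).neg.add
      ((((h.lead.lower (l := -e + 1) (by omega)).sub hβ).mul d1).congr (by ring) rfl rfl)).congr
      rfl (by ring) rfl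
  have c3 : LeadAt c (-e) (-(2 * a 1 * (2 * ℓ - δ)) - β' * (2 * e)) (coupling T f 3) := by
    have hc : coupling T f 3 =
        -(2 * f 1 * (T - (f 0 + f 3))) + (T - f 3) * (2 * (f 1 + f 4) - T) := by
      have := (h.rotate 3).coupling_zero_eq
      rw [coupling_comp_add] at this
      refine this.trans ?_
      show -(2 * f 1 * (T - (f 3 + f 0))) + (T - f 3) * (2 * (f 4 + f 1) - T) = _
      ring
    rw [hc]
    refine ((((ha 1).two_mul.mul (h.lead.sub hδ)).congr (l := -e) (by ring) rfl rfl).neg.add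
      ((((h.lead.lower (l := -e + 1) (by omega)).sub hβ').mul d1).congr (by ring) rfl rfl)).congr
      rfl (by ring) rfl
  -- If `f i` has order at most `0`, dividing the bound by `f i` leaves a coupling of order at least
  -- `-1`, which exceeds `-e`.
  have small : ∀ i, (∃ b, LeadAt c 1 b (f i)) ∨ LeadAt c (-e) 0 (coupling T f i) := by
    intro i
    rw [or_iff_not_imp_left]
    intro hi
    obtain ⟨k, b, hk1, hb, hk⟩ := h.exists_large_order hi
    obtain ⟨b', hb'⟩ := h.bound i k b hk
    exact (hk.of_mul hb hb').lower (by omega)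
  -- If the coefficient in `c0` vanished, subtracting it from `r2` would leave `2 * ℓ * a 4 = 0`.
  have s0 : ∃ b, LeadAt c 1 b (f 0) := by
    refine (small 0).resolve_right fun hc => ?_
    have := c0.unique hc
    have : a 4 * ℓ = 0 := by linear_combination (r2 - this) / 2
    simp [h4, hℓ] at this
  have s3 : ∃ b, LeadAt c 1 b (f 3) := by
    refine (small 3).resolve_right fun hc => ?_
    have := c3.unique hc
    have : a 4 * ℓ = 0 := by linear_combination (this - r5) / 2 + ℓ * o1
    simp [h4, hℓ] at this
  obtain ⟨b0, hb0⟩ := s0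
  obtain ⟨b3, hb3⟩ := s3
  -- Now `f 0` and `f 3` vanish at `c`, so `δ = β = 0` and `r2` reduces to the impossible `-2 * ℓ *
  -- a 4 = 0`.
  have hδ0 : δ = 0 := hδ.unique
    (((hb0.lower (l := 0) (by omega)).add (hb3.lower (by omega))).congr rfl (by ring) rfl)
  have hβ0 : β = 0 := hβ.unique (hb0.lower (by omega))
  rw [hδ0, hβ0] at r2
  have : a 4 * ℓ = 0 := by linear_combination -r2 / 2
  simp [h4, hℓ] at this

theorem lead_eq_zero_of_high_order {ℓ : ℂ} (h : LocalSystem c (2 * ℓ) 1 T f) (he : 2 ≤ e)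
    (ha : ∀ i, LeadAt c (-e) (a i) (f i))
    (hE : ∀ i, LeadAt c (-e - 1) (-(ℓ * e * a i)) (f i * coupling T f i)) :
    a 0 = 0 ∧ a 2 = 0 ∧ a 4 = 0 := by
  obtain ⟨o3, o5, o1⟩ := h.opposite (by omega) (by omega) ha
  have hs : a 0 + a 2 + a 4 = 0 := h.sum_lead (by omega) ha 0
  have hℓ : ℓ ≠ 0 := by simpa using h.ne_zero
  have hdiff : ∀ i, a (i + 3) = -a i → a i ≠ 0 →
      LeadAt c (-1) (-e) (f (i + 1) + f (i + 4) - (f (i + 2) + f (i + 5))) := fun i hop hai =>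
    (h.diff_lead ha hop hai (hE i) (hE (i + 3))).congr (by ring) (by rw [hop]; field_simp; ring) rfl
  have hrot : ∀ s : ZMod 6, a s = 0 → a (s + 2) = 0 := by
    intro s hs0
    by_contra hne
    refine (h.rotate s).false_of_high_order (a := fun i => a (i + s)) he (fun i => ha (i + s))
      (fun i => ?_) (by simpa using hs0) (by simpa [add_comm] using hne)
    rw [coupling_comp_add]
    exact hE (i + s)
  have t0 : a 0 = 0 → a 2 = 0 := hrot 0
  have t2 : a 2 = 0 → a 4 = 0 := hrot 2
  have t4 : a 4 = 0 → a 0 = 0 := hrot 4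
  by_cases z0 : a 0 = 0
  · exact ⟨z0, t0 z0, t2 (t0 z0)⟩
  by_cases z2 : a 2 = 0
  · exact ⟨t4 (t2 z2), z2, t2 z2⟩
  by_cases z4 : a 4 = 0
  · exact ⟨t4 z4, t0 (t4 z4), z4⟩
  exfalso
  have D0 : LeadAt c (-1) (-e) (f 1 + f 4 - (f 2 + f 5)) := hdiff 0 o3 z0
  have D2 : LeadAt c (-1) (-e) (f 3 + f 0 - (f 4 + f 1)) := hdiff 2 o5 z2
  have D4 : LeadAt c (-1) (-e) (f 5 + f 2 - (f 0 + f 3)) := hdiff 4 o1 z4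
  -- The three differences add up to zero, yet each has coefficient `-e` at order `-1`.
  have : (-e + -e + -e : ℂ) = 0 := ((D0.add D2).add D4).unique (LeadAt.zero.congr rfl rfl (by ring))
  have : (e : ℂ) = 0 := by linear_combination -this / 3
  have : e = 0 := by exact_mod_cast this
  omega

end LocalSystem

end PainleveA5

/-! ### Residues and constant terms at a simple pole. -/

namespace PainleveA5

/-- The leading data of the six functions at a finite nonzero point: residues `a i` and constant
terms `r i`. -/
structure PoleData (c : ℂ) (a r : ZMod 6 → ℂ) : Prop where
  ne_zero : c ≠ 0
  sum_a : ∀ i, a i + a (i + 2) + a (i + 4) = 0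
  sum_r : ∀ i, r i + r (i + 2) + r (i + 4) = c
  cubic : ∀ i, a i * (a (i + 2) * (2 * a (i + 1)) - a (i + 4) * (2 * a (i + 5))) = 0
  quadratic : ∀ i, a i * (a (i + 2) * (2 * r (i + 1) - c) + r (i + 2) * (2 * a (i + 1)) -
      (a (i + 4) * (2 * r (i + 5) - c) + r (i + 4) * (2 * a (i + 5)))) +
    r i * (a (i + 2) * (2 * a (i + 1)) - a (i + 4) * (2 * a (i + 5))) = -(c / 2) * a i
  linear : ∀ i, a i = 0 → a (i + 2) * (2 * a (i + 1)) - a (i + 4) * (2 * a (i + 5)) = 0 →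
    r i * (a (i + 2) * (2 * r (i + 1) - c) + r (i + 2) * (2 * a (i + 1)) -
      (a (i + 4) * (2 * r (i + 5) - c) + r (i + 4) * (2 * a (i + 5)))) = 0

namespace PoleData

variable {c : ℂ} {a r : ZMod 6 → ℂ}

theorem rotate (h : PoleData c a r) (s : ZMod 6) :
    PoleData c (fun i => a (i + s)) (fun i => r (i + s)) where
  ne_zero := h.ne_zero
  sum_a i := by simpa only [add_right_comm] using h.sum_a (i + s)
  sum_r i := by simpa only [add_right_comm] using h.sum_r (i + s)
  cubic i := by simpa only [add_right_comm] using h.cubic (i + s)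
  quadratic i := by simpa only [add_right_comm] using h.quadratic (i + s)
  linear i := by simpa only [add_right_comm] using h.linear (i + s)

/-- Poles in one parity class only. -/
theorem single (h : PoleData c a r) (h0 : a 0 = 0) (h1 : a 1 = 0) (h3 : a 3 = 0) (h5 : a 5 = 0) :
    a 2 = 0 ∧ a 4 = 0 ∨ a 4 = -a 2 ∧ (a 2 = -1 / 2 ∧ r 3 = 0 ∨ a 2 = 1 / 2 ∧ r 3 = c) := by
  have hs : a 0 + a 2 + a 4 = 0 := h.sum_a 0
  have ht : r 1 + r 3 + r 5 = c := h.sum_r 1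
  have q2 : a 2 * (a 4 * (2 * r 3 - c) + r 4 * (2 * a 3) - (a 0 * (2 * r 1 - c) + r 0 * (2 * a 1)))
    + r 2 * (a 4 * (2 * a 3) - a 0 * (2 * a 1)) = -(c / 2) * a 2 := h.quadratic 2
  have l3 : a 3 = 0 → a 5 * (2 * a 4) - a 1 * (2 * a 2) = 0 →
    r 3 * (a 5 * (2 * r 4 - c) + r 5 * (2 * a 4) - (a 1 * (2 * r 2 - c) + r 1 * (2 * a 2))) = 0 :=
    h.linear 3
  have hc := h.ne_zero
  clear h
  generalize a 0 = a0 at *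
  generalize a 1 = a1 at *
  generalize a 2 = a2 at *
  generalize a 3 = a3 at *
  generalize a 4 = a4 at *
  generalize a 5 = a5 at *
  subst h0 h1 h3 h5
  have h4 : a4 = -a2 := by linear_combination hs
  subst h4
  by_cases z2 : a2 = 0
  · simp [z2]
  right
  refine ⟨rfl, ?_⟩
  have l3' : r 3 * (c - r 3) = 0 := by
    have := l3 rfl (by ring)
    have : a2 * (r 3 * (c - r 3)) = 0 := by linear_combination -this / 2 - a2 * r 3 * ht
    simpa [z2] using this
  have q2' : a2 * (2 * r 3 - c) = c / 2 := by
    apply mul_left_cancel₀ z2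
    linear_combination -q2
  rcases mul_eq_zero.1 l3' with h3 | h3
  · left
    refine ⟨?_, h3⟩
    apply mul_right_cancel₀ hc
    linear_combination -q2' + 2 * a2 * h3
  · right
    have h3 : r 3 = c := by linear_combination -h3
    refine ⟨?_, h3⟩
    apply mul_right_cancel₀ hc
    linear_combination q2' - 2 * a2 * h3

/-- Poles in both parity classes. -/
theorem double (h : PoleData c a r) (h0 : a 0 = 0) (h3 : a 3 = 0) (h2 : a 2 ≠ 0) (h5 : a 5 ≠ 0) :
    a 4 = -a 2 ∧ a 1 = -a 5 ∧ (a 2 = -1 / 2 ∧ a 5 = -1 / 2 ∧ r 0 = 0 ∧ r 3 = 0 ∨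
      a 2 = 1 / 2 ∧ a 5 = -3 / 2 ∧ r 0 = 0 ∧ r 3 = c ∨
      a 2 = -3 / 2 ∧ a 5 = 1 / 2 ∧ r 0 = c ∧ r 3 = 0) := by
  have hs : a 0 + a 2 + a 4 = 0 := h.sum_a 0
  have hs' : a 1 + a 3 + a 5 = 0 := h.sum_a 1
  have ht : r 0 + r 2 + r 4 = c := h.sum_r 0
  have ht' : r 1 + r 3 + r 5 = c := h.sum_r 1
  have q2 : a 2 * (a 4 * (2 * r 3 - c) + r 4 * (2 * a 3) - (a 0 * (2 * r 1 - c) + r 0 * (2 * a 1)))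
    + r 2 * (a 4 * (2 * a 3) - a 0 * (2 * a 1)) = -(c / 2) * a 2 := h.quadratic 2
  have q5 : a 5 * (a 1 * (2 * r 0 - c) + r 1 * (2 * a 0) - (a 3 * (2 * r 4 - c) + r 3 * (2 * a 4)))
    + r 5 * (a 1 * (2 * a 0) - a 3 * (2 * a 4)) = -(c / 2) * a 5 := h.quadratic 5
  have l0 : a 0 = 0 → a 2 * (2 * a 1) - a 4 * (2 * a 5) = 0 →
    r 0 * (a 2 * (2 * r 1 - c) + r 2 * (2 * a 1) - (a 4 * (2 * r 5 - c) + r 4 * (2 * a 5))) = 0 :=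
    h.linear 0
  have l3 : a 3 = 0 → a 5 * (2 * a 4) - a 1 * (2 * a 2) = 0 →
    r 3 * (a 5 * (2 * r 4 - c) + r 5 * (2 * a 4) - (a 1 * (2 * r 2 - c) + r 1 * (2 * a 2))) = 0 :=
    h.linear 3
  have hc := h.ne_zero
  clear h
  generalize a 0 = a0 at *
  generalize a 1 = a1 at *
  generalize a 2 = a2 at *
  generalize a 3 = a3 at *
  generalize a 4 = a4 at *
  generalize a 5 = a5 at *
  subst h0 h3
  have h4 : a4 = -a2 := by linear_combination hs
  have h1 : a1 = -a5 := by linear_combination hs'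
  subst h4 h1
  refine ⟨rfl, rfl, ?_⟩
  have q2' : -a2 * (2 * r 3 - c) + 2 * r 0 * a5 = -(c / 2) := by
    apply mul_left_cancel₀ h2
    linear_combination q2
  have q5' : -a5 * (2 * r 0 - c) + 2 * r 3 * a2 = -(c / 2) := by
    apply mul_left_cancel₀ h5
    linear_combination q5
  have hsum : a2 + a5 = -1 := by
    apply mul_right_cancel₀ hc
    linear_combination q2' + q5'
  have l0' : r 0 * (a2 * r 3 + a5 * (c - r 0)) = 0 := by
    linear_combination -(l0 rfl (by ring)) / 2 + r 0 * a2 * ht' - r 0 * a5 * ht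
  have l3' : r 3 * (a5 * r 0 + a2 * (c - r 3)) = 0 := by
    linear_combination -(l3 rfl (by ring)) / 2 + r 3 * a5 * ht - r 3 * a2 * ht'
  by_cases z0 : r 0 = 0
  · rw [z0] at l3' q2'
    have : r 3 * (c - r 3) = 0 := by
      apply mul_left_cancel₀ h2
      linear_combination l3'
    rcases mul_eq_zero.1 this with z3 | z3
    · rw [z3] at q2'
      have : a2 = -1 / 2 := by
        apply mul_right_cancel₀ hc
        linear_combination q2'
      exact Or.inl ⟨this, by linear_combination hsum - this, z0, z3⟩
    · have z3 : r 3 = c := by linear_combination -z3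
      rw [z3] at q2'
      have : a2 = 1 / 2 := by
        apply mul_right_cancel₀ hc
        linear_combination -q2'
      exact Or.inr (Or.inl ⟨this, by linear_combination hsum - this, z0, z3⟩)
  · have e0 : a2 * r 3 + a5 * (c - r 0) = 0 := by simpa [z0] using l0'
    by_cases z3 : r 3 = 0
    · rw [z3] at e0 q5'
      have : c - r 0 = 0 := by
        apply mul_left_cancel₀ h5
        linear_combination e0
      have hr : r 0 = c := by linear_combination -this
      rw [hr] at q5'
      have : a5 = 1 / 2 := by
        apply mul_right_cancel₀ hc
        linear_combination -q5'
      exact Or.inr (Or.inr ⟨by linear_combination hsum - this, this, hr, z3⟩)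
    -- Adding `e0` and `e3` gives `c * (a2 + a5) = 0`, contrary to `hsum`.
    · have e3 : a5 * r 0 + a2 * (c - r 3) = 0 := by simpa [z3] using l3'
      exact absurd (by linear_combination c * hsum - e0 - e3) hc

/-- The residue of the auxiliary function is a natural multiple of `c / 12`. -/
def ResidueLaw (c : ℂ) (a r : ZMod 6 → ℂ) : Prop :=
  ∑ i, (2 * (a i * a (i + 1) * a (i + 2)) + a i * a (i + 1) * a (i + 3) +
      a i * a (i + 1) * a (i + 4)) = 0 ∧
  ∃ m : ℕ, (m = 0 → ∀ i, a i = 0) ∧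
    -4 * ∑ i, (2 * (a i * a (i + 1) * r (i + 2) + a i * r (i + 1) * a (i + 2) +
        r i * a (i + 1) * a (i + 2)) +
      (a i * a (i + 1) * r (i + 3) + a i * r (i + 1) * a (i + 3) + r i * a (i + 1) * a (i + 3)) +
      (a i * a (i + 1) * r (i + 4) + a i * r (i + 1) * a (i + 4) + r i * a (i + 1) * a (i + 4))) =
    m * c

theorem ResidueLaw.of_rotate (s : ZMod 6)
    (h : ResidueLaw c (fun i => a (i + s)) (fun i => r (i + s))) : ResidueLaw c a r := by
  obtain ⟨h1, m, hm, h2⟩ := h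
  have e : ∀ i k : ZMod 6, i + s + k = i + k + s := fun i k => add_right_comm i s k
  refine ⟨?_, m, fun h0 i => by simpa using hm h0 (i - s), ?_⟩
  · rw [← Equiv.sum_comp (Equiv.addRight s)]
    simpa only [Equiv.coe_addRight, e] using h1
  · rw [← Equiv.sum_comp (Equiv.addRight s)]
    simpa only [Equiv.coe_addRight, e] using h2

theorem residueLaw_of_eq_zero (h : ∀ i, a i = 0) : ResidueLaw c a r := by
  refine ⟨by simp [h], 0, fun _ => h, by simp [h]⟩

theorem residueLaw_single (h : PoleData c a r) (h0 : a 0 = 0) (h1 : a 1 = 0) (h3 : a 3 = 0)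
    (h5 : a 5 = 0) : ResidueLaw c a r := by
  have ht : r 0 + r 2 + r 4 = c := h.sum_r 0
  have ht' : r 1 + r 3 + r 5 = c := h.sum_r 1
  rcases h.single h0 h1 h3 h5 with ⟨h2, h4⟩ | ⟨h4, ⟨h2, hr⟩ | ⟨h2, hr⟩⟩
  · exact residueLaw_of_eq_zero (forall_zmod_six h0 h1 h2 h3 h4 h5)
  · rw [h2] at h4
    refine ⟨?_, 1, by simp, ?_⟩
    · simp only [sum_zmod_six, zmod_six_add, zero_add, h0, h1, h2, h3, h4, h5]
      ring
    · simp only [sum_zmod_six, zmod_six_add, zero_add, h0, h1, h2, h3, h4, h5]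
      linear_combination ht' + hr
  · rw [h2] at h4
    refine ⟨?_, 2, by simp, ?_⟩
    · simp only [sum_zmod_six, zmod_six_add, zero_add, h0, h1, h2, h3, h4, h5]
      ring
    · simp only [sum_zmod_six, zmod_six_add, zero_add, h0, h1, h2, h3, h4, h5]
      push_cast
      linear_combination ht' + hr

theorem residueLaw_double (h : PoleData c a r) (h0 : a 0 = 0) (h3 : a 3 = 0) (h2 : a 2 ≠ 0)
    (h5 : a 5 ≠ 0) : ResidueLaw c a r := by
  have ht : r 0 + r 2 + r 4 = c := h.sum_r 0
  have ht' : r 1 + r 3 + r 5 = c := h.sum_r 1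
  obtain ⟨h4, h1, ⟨h2, h5, e0, e3⟩ | ⟨h2, h5, e0, e3⟩ | ⟨h2, h5, e0, e3⟩⟩ := h.double h0 h3 h2 h5 <;>
    rw [h2] at h4 <;> rw [h5] at h1
  · refine ⟨?_, 2, by simp, ?_⟩
    · simp only [sum_zmod_six, zmod_six_add, zero_add, h0, h1, h2, h3, h4, h5]
      ring
    · simp only [sum_zmod_six, zmod_six_add, zero_add, h0, h1, h2, h3, h4, h5]
      push_cast
      linear_combination ht' + ht + 3 * e3 + 3 * e0
  · refine ⟨?_, 5, by simp, ?_⟩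
    · simp only [sum_zmod_six, zmod_six_add, zero_add, h0, h1, h2, h3, h4, h5]
      ring
    · simp only [sum_zmod_six, zmod_six_add, zero_add, h0, h1, h2, h3, h4, h5]
      push_cast
      linear_combination ht' + 9 * ht - 5 * e3 + 3 * e0
  · refine ⟨?_, 5, by simp, ?_⟩
    · simp only [sum_zmod_six, zmod_six_add, zero_add, h0, h1, h2, h3, h4, h5]
      ring
    · simp only [sum_zmod_six, zmod_six_add, zero_add, h0, h1, h2, h3, h4, h5]
      push_cast
      linear_combination 9 * ht' + ht + 3 * e3 - 5 * e0

/-- The point is that `a 0`, `a 2`, `a 4` cannot all be nonzero. If `r 1`, `r 3`, `r 5` are all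
nonzero, the linear relations make `(a 0, a 2, a 4)` proportional to `(r 3, r 5, r 1)`, whose sum is
`c` instead of `0`. Otherwise the linear relations leave only one nonzero constant term, equal to
`c`, and the quadratic relations then force some `a i = 0`. -/
theorem residueLaw_of_odd (h : PoleData c a r) (h1 : a 1 = 0) (h3 : a 3 = 0) (h5 : a 5 = 0) :
    ResidueLaw c a r := by
  by_cases h0 : a 0 = 0
  · exact h.residueLaw_single h0 h1 h3 h5
  by_cases h2 : a 2 = 0
  · exact .of_rotate 2 ((h.rotate 2).residueLaw_single h2 h3 h5 h1)
  by_cases h4 : a 4 = 0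
  · exact .of_rotate 4 ((h.rotate 4).residueLaw_single h4 h5 h1 h3)
  exfalso
  have hs : a 0 + a 2 + a 4 = 0 := h.sum_a 0
  have ht : r 1 + r 3 + r 5 = c := h.sum_r 1
  have q0 := h.quadratic 0
  have q2 := h.quadratic 2
  have q4 := h.quadratic 4
  have l1 := h.linear 1
  have l3 := h.linear 3
  have l5 := h.linear 5
  simp only [zmod_six_add, zero_add, h1, h3, h5] at q0 q2 q4 l1 l3 l5
  have hc := h.ne_zero
  clear h
  generalize a 0 = a0 at *
  generalize a 2 = a2 at *
  generalize a 4 = a4 at *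
  generalize r 1 = r1 at *
  generalize r 3 = r3 at *
  generalize r 5 = r5 at *
  have q0' : a2 * (2 * r1 - c) - a4 * (2 * r5 - c) = -(c / 2) := by
    apply mul_left_cancel₀ h0
    linear_combination q0
  have q2' : a4 * (2 * r3 - c) - a0 * (2 * r1 - c) = -(c / 2) := by
    apply mul_left_cancel₀ h2
    linear_combination q2
  have q4' : a0 * (2 * r5 - c) - a2 * (2 * r3 - c) = -(c / 2) := by
    apply mul_left_cancel₀ h4
    linear_combination q4
  have l1' : r1 * (r3 * a2 - r5 * a0) = 0 := by linear_combination l1 trivial (by ring) / 2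
  have l3' : r3 * (r5 * a4 - r1 * a2) = 0 := by linear_combination l3 trivial (by ring) / 2
  have l5' : r5 * (r1 * a0 - r3 * a4) = 0 := by linear_combination l5 trivial (by ring) / 2
  clear q0 q2 q4 l1 l3 l5
  by_cases z1 : r1 = 0 <;> by_cases z3 : r3 = 0 <;> by_cases z5 : r5 = 0 <;> grind

/-- The two sums in `ResidueLaw` come from the triple-pole and double-pole coefficients of the cubic
part of `H'`. Up to rotation, the surviving configurations have `m` equal to `0`, `1`, `2` or `5`.
-/
theorem residueLaw (h : PoleData c a r) : ResidueLaw c a r := by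
  rcases parallel_or_zero (h.sum_a 0) (h.sum_a 1) (h.cubic 0) (h.cubic 2)
    with ⟨h0, h2, h4⟩ | ⟨h1, h3, h5⟩ | ⟨κ, hκ, h3, h5, h1⟩
  · exact .of_rotate 1 ((h.rotate 1).residueLaw_of_odd h2 h4 h0)
  · exact h.residueLaw_of_odd h1 h3 h5
  · have hs : a 0 + a 2 + a 4 = 0 := h.sum_a 0
    change a 3 = κ * a 0 at h3
    change a 5 = κ * a 2 at h5
    change a 1 = κ * a 4 at h1
    by_cases h0 : a 0 = 0
    · by_cases h2 : a 2 = 0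
      · have h4 : a 4 = 0 := by linear_combination hs - h0 - h2
        exact residueLaw_of_eq_zero (forall_zmod_six h0 (by simp [h1, h4]) h2 (by simp [h3, h0]) h4
          (by simp [h5, h2]))
      · exact h.residueLaw_double h0 (by simp [h3, h0]) h2 (by simp [h5, h2, hκ])
    by_cases h2 : a 2 = 0
    · have h4 : a 4 ≠ 0 := fun h4 => h0 (by linear_combination hs - h2 - h4)
      exact .of_rotate 2 ((h.rotate 2).residueLaw_double h2 (show a 5 = 0 by simp [h5, h2]) h4
        (show a 1 ≠ 0 by simp [h1, h4, hκ]))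
    by_cases h4 : a 4 = 0
    · exact .of_rotate 4 ((h.rotate 4).residueLaw_double h4 (show a 1 = 0 by simp [h1, h4]) h0
        (show a 3 ≠ 0 by simp [h3, h0, hκ]))
    exfalso
    have ht : r 0 + r 2 + r 4 = c := h.sum_r 0
    have ht' : r 1 + r 3 + r 5 = c := h.sum_r 1
    have hq : ∀ i, a i ≠ 0 → a (i + 2) * (2 * r (i + 1) - c) + r (i + 2) * (2 * a (i + 1)) -
      (a (i + 4) * (2 * r (i + 5) - c) + r (i + 4) * (2 * a (i + 5))) = -(c / 2) := by
      intro i hi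
      have h1 := h.quadratic i
      have h2 := (mul_eq_zero.1 (h.cubic i)).resolve_left hi
      apply mul_left_cancel₀ hi
      linear_combination h1 - r i * h2
    have q0 := hq 0 h0
    have q2 := hq 2 h2
    have q4 := hq 4 h4
    have q1 := hq 1 (by simp [h1, hκ, h4])
    have q3 := hq 3 (by simp [h3, hκ, h0])
    have q5 := hq 5 (by simp [h5, hκ, h2])
    simp only [zmod_six_add, zero_add] at q0 q1 q2 q3 q4 q5
    -- If all six residues are nonzero, the left sides cancel in the cyclic sum while the right
    -- sides add up to `-3 * c`.
    exact h.ne_zero (by linear_combination (q0 + q1 + q2 + q3 + q4 + q5) / 3)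

end PoleData

open PoleData

/-! ### The derivative of the auxiliary function -/

/-- Averaging over `i` makes `H` invariant under rotation of the indices, so the coefficients can be
collected by parameter. -/
theorem auxH_eq (α : ZMod 6 → ℂ) (f : ZMod 6 → RatFunc ℂ) :
    auxH α f = (∑ j, f j * f (j + 1) * f (j + 2) * f (j + 3)) +
      RatFunc.C (1 / 6) * ∑ i, RatFunc.C (α i) *
        (-(f i * f (i + 1)) - 3 * (f (i + 1) * f (i + 2)) + f (i + 2) * f (i + 3) -
          f (i + 3) * f (i + 4) + 3 * (f (i + 4) * f (i + 5)) + f (i + 5) * f i -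
          2 * (f (i + 1) * f (i + 4)) + 2 * (f (i + 2) * f (i + 5))) := by
  have h3 : (RatFunc.C (1 / 3) : RatFunc ℂ) = 1 / 3 := by rw [map_div₀, map_one, map_ofNat]
  have h6 : (RatFunc.C (1 / 6) : RatFunc ℂ) = 1 / 6 := by rw [map_div₀, map_one, map_ofNat]
  simp only [auxH, hamiltonianTilde, hamiltonian, add_sub_cancel_right, map_mul, map_add, map_sub,
    map_ofNat, h3, h6, sum_zmod_six, zmod_six_add, zero_add]
  ring

/-- The explicit form of the derivative of the auxiliary function, as an identity in a field. -/
theorem deriv_identity {K : Type*} [Field K] [CharZero K]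
    {t f0 f1 f2 f3 f4 f5 a0 a1 a2 a3 a4 a5 d0 d1 d2 d3 d4 d5 : K} (ht : t ≠ 0)
    (h4 : f4 = t - f0 - f2) (h5 : f5 = t - f1 - f3) (ha : a5 = 1 - a0 - a1 - a2 - a3 - a4)
    (e4 : d4 = 1 - d0 - d2) (e5 : d5 = 1 - d1 - d3)
    (o0 : t / 2 * d0 = f0 * (f1 * f2 + f1 * f4 + f3 * f4 - f2 * f3 - f2 * f5 - f4 * f5) +
      (1 / 2 - a2 - a4) * f0 + a0 * (f2 + f4))
    (o1 : t / 2 * d1 = f1 * (f2 * f3 + f2 * f5 + f4 * f5 - f3 * f4 - f3 * f0 - f5 * f0) +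
      (1 / 2 - a3 - a5) * f1 + a1 * (f3 + f5))
    (o2 : t / 2 * d2 = f2 * (f3 * f4 + f3 * f0 + f5 * f0 - f4 * f5 - f4 * f1 - f0 * f1) +
      (1 / 2 - a4 - a0) * f2 + a2 * (f4 + f0))
    (o3 : t / 2 * d3 = f3 * (f4 * f5 + f4 * f1 + f0 * f1 - f5 * f0 - f5 * f2 - f1 * f2) +
      (1 / 2 - a5 - a1) * f3 + a3 * (f5 + f1)) :
    (d0 * f1 * f2 * f3 + f0 * d1 * f2 * f3 + f0 * f1 * d2 * f3 + f0 * f1 * f2 * d3) + (d1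
    * f2 * f3 * f4 + f1 * d2 * f3 * f4 + f1 * f2 * d3 * f4 + f1 * f2 * f3 * d4) + (d2 * f3
    * f4 * f5 + f2 * d3 * f4 * f5 + f2 * f3 * d4 * f5 + f2 * f3 * f4 * d5) + (d3 * f4 * f5
    * f0 + f3 * d4 * f5 * f0 + f3 * f4 * d5 * f0 + f3 * f4 * f5 * d0) + (d4 * f5 * f0 * f1
    + f4 * d5 * f0 * f1 + f4 * f5 * d0 * f1 + f4 * f5 * f0 * d1) + (d5 * f0 * f1 * f2 + f5
    * d0 * f1 * f2 + f5 * f0 * d1 * f2 + f5 * f0 * f1 * d2) + 1 / 6 * (a0 * (-(d0 * f1 +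
    f0 * d1) - 3 * (d1 * f2 + f1 * d2) + (d2 * f3 + f2 * d3) - (d3 * f4 + f3 * d4) + 3 *
    (d4 * f5 + f4 * d5) + (d5 * f0 + f5 * d0) - 2 * (d1 * f4 + f1 * d4) + 2 * (d2 * f5 +
    f2 * d5)) + a1 * (-(d1 * f2 + f1 * d2) - 3 * (d2 * f3 + f2 * d3) + (d3 * f4 + f3 * d4)
    - (d4 * f5 + f4 * d5) + 3 * (d5 * f0 + f5 * d0) + (d0 * f1 + f0 * d1) - 2 * (d2 * f5 +
    f2 * d5) + 2 * (d3 * f0 + f3 * d0)) + a2 * (-(d2 * f3 + f2 * d3) - 3 * (d3 * f4 + f3 *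
    d4) + (d4 * f5 + f4 * d5) - (d5 * f0 + f5 * d0) + 3 * (d0 * f1 + f0 * d1) + (d1 * f2 +
    f1 * d2) - 2 * (d3 * f0 + f3 * d0) + 2 * (d4 * f1 + f4 * d1)) + a3 * (-(d3 * f4 + f3 *
    d4) - 3 * (d4 * f5 + f4 * d5) + (d5 * f0 + f5 * d0) - (d0 * f1 + f0 * d1) + 3 * (d1 *
    f2 + f1 * d2) + (d2 * f3 + f2 * d3) - 2 * (d4 * f1 + f4 * d1) + 2 * (d5 * f2 + f5 *
    d2)) + a4 * (-(d4 * f5 + f4 * d5) - 3 * (d5 * f0 + f5 * d0) + (d0 * f1 + f0 * d1) -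
    (d1 * f2 + f1 * d2) + 3 * (d2 * f3 + f2 * d3) + (d3 * f4 + f3 * d4) - 2 * (d5 * f2 +
    f5 * d2) + 2 * (d0 * f3 + f0 * d3)) + a5 * (-(d5 * f0 + f5 * d0) - 3 * (d0 * f1 + f0 *
    d1) + (d1 * f2 + f1 * d2) - (d2 * f3 + f2 * d3) + 3 * (d3 * f4 + f3 * d4) + (d4 * f5 +
    f4 * d5) - 2 * (d0 * f3 + f0 * d3) + 2 * (d1 * f4 + f1 * d4))) =
    1 / 3 * ((2 * (f0 * f1 * f2) + f0 * f1 * f3 + f0 * f1 * f4) + (2 * (f1 * f2 * f3)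
      + f1 * f2 * f4 + f1 * f2 * f5) + (2 * (f2 * f3 * f4) + f2 * f3 * f5 + f2 * f3 *
      f0) + (2 * (f3 * f4 * f5) + f3 * f4 * f0 + f3 * f4 * f1) + (2 * (f4 * f5 * f0) +
      f4 * f5 * f1 + f4 * f5 * f2) + (2 * (f5 * f0 * f1) + f5 * f0 * f2 + f5 * f0 * f3))
      + 1 / 3 * ((-a0 + 2 * a1 - a2 + a3 - a4) * f0 + (-a1 + 2 * a2 - a3 + a4 - a5) * f1
      + (-a2 + 2 * a3 - a4 + a5 - a0) * f2 + (-a3 + 2 * a4 - a5 + a0 - a1) * f3 + (-a4 +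
      2 * a5 - a0 + a1 - a2) * f4 + (-a5 + 2 * a0 - a1 + a2 - a3) * f5) := by
  subst h4 h5 ha e4 e5
  have ht2 : t / 2 ≠ 0 := by simpa using ht
  apply mul_left_cancel₀ ht2
  -- With `f4`, `f5`, `a5` eliminated, the multiplier of each equation is the partial derivative of
  -- `H` with respect to the corresponding one of `f0`, `f1`, `f2`, `f3`, as it must be for the
  -- `d`'s to cancel.
  linear_combination (a0 * f1 + a0 * f3 + a1 * t + a2 * f1 + a2 * f3 + a3 * t + a4 * f1 + a4 * f3 + 4 * f0
    * f1 * f3 + (-2) * f0 * f1 * t + 2 * f0 * f1 ^ 2 + (-2) * f0 * f3 * t + 2 * f0 * f3 ^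
    2 + (-1 / 2) * f1 + 2 * f1 * f2 * f3 + (-2) * f1 * f3 * t + f1 * t ^ 2 + (-1) * f1 ^ 2
    * t + (-2) * f2 * f3 * t + 2 * f2 * f3 ^ 2 + (-1 / 2) * f3 + f3 * t ^ 2 + (-1) * f3 ^
    2 * t + (-1 / 3) * t) * o0 + (a0 * f0 + (-1) * a0 * t + a2 * f0 + a4 * f0 + (-1 / 2) *
    f0 + (-2) * f0 * f1 * t + 2 * f0 * f2 * f3 + (-2) * f0 * f3 * t + f0 * t ^ 2 + 2 * f0
    ^ 2 * f1 + 2 * f0 ^ 2 * f3 + (-1) * f0 ^ 2 * t + (1 / 6) * t) * o1 + (a0 * f3 + a2 *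
    f3 + a3 * t + a4 * f3 + 2 * f0 * f1 * f3 + (-2) * f0 * f3 * t + 2 * f0 * f3 ^ 2 + (-2)
    * f2 * f3 * t + 2 * f2 * f3 ^ 2 + (-1 / 2) * f3 + f3 * t ^ 2 + (-1) * f3 ^ 2 * t + (-1
    / 6) * t) * o2 + (a0 * f0 + a0 * f2 + (-1) * a0 * t + a2 * f0 + a2 * f2 + (-1) * a2 *
    t + a4 * f0 + a4 * f2 + (-1 / 2) * f0 + 2 * f0 * f1 * f2 + (-2) * f0 * f1 * t + 4 * f0
    * f2 * f3 + (-2) * f0 * f2 * t + (-2) * f0 * f3 * t + f0 * t ^ 2 + 2 * f0 ^ 2 * f1 + 2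
    * f0 ^ 2 * f3 + (-1) * f0 ^ 2 * t + (-1 / 2) * f2 + (-2) * f2 * f3 * t + f2 * t ^ 2 +
    2 * f2 ^ 2 * f3 + (-1) * f2 ^ 2 * t + (1 / 3) * t) * o3

theorem ratDeriv_ofNat (n : ℕ) [n.AtLeastTwo] :
    ratDeriv (OfNat.ofNat n : RatFunc ℂ) = 0 := by
  rw [← map_ofNat (RatFunc.C (K := ℂ)), ratDeriv_C]

namespace IsRationalSolution

variable {α : ZMod 6 → ℂ} {f : ZMod 6 → RatFunc ℂ}

theorem sum_eq (h : IsRationalSolution α f) (i : ZMod 6) : f i + f (i + 2) + f (i + 4) = RatFunc.X := by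
  refine forall_zmod_six (p := fun i => f i + f (i + 2) + f (i + 4) = RatFunc.X) ?_ ?_ ?_ ?_ ?_ ?_ i <;>
    simp only [zmod_six_add, zero_add]
  · exact h.sum_even
  · exact h.sum_odd
  · rw [← h.sum_even]; ring
  · rw [← h.sum_odd]; ring
  · rw [← h.sum_even]; ring
  · rw [← h.sum_odd]; ring

theorem sum_eq' (h : IsRationalSolution α f) (i : ZMod 6) :
    f (i + 1) + f (i + 3) + f (i + 5) = RatFunc.X := by
  have := h.sum_eq (i + 1)
  rwa [add_assoc i 1 2, add_assoc i 1 4, show (1 + 2 : ZMod 6) = 3 from rfl,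
    show (1 + 4 : ZMod 6) = 5 from rfl] at this

/-- The opposite-parity sum eliminates `f (i + 3)`, which puts the cubic part in the form `f i *
coupling`. -/
theorem mul_coupling (h : IsRationalSolution α f) (i : ZMod 6) :
    f i * coupling RatFunc.X f i = RatFunc.C (1 / 2) * (RatFunc.X * ratDeriv (f i)) -
      RatFunc.C (1 / 2 - α (i + 2) - α (i + 4)) * f i -
      RatFunc.C (α i) * (RatFunc.X - f i) := by
  have h1 := h.ode i
  have h2 : (RatFunc.C (1 / 2) : RatFunc ℂ) = 1 / 2 := by rw [map_div₀, map_one, map_ofNat]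
  have h3 := h.sum_eq i
  have h4 := h.sum_eq' i
  rw [h2, coupling]
  linear_combination -h1 - RatFunc.C (α i) * h3 + f i * (f (i + 2) - f (i + 4)) * h4

theorem deriv_auxH (h : IsRationalSolution α f) :
    ratDeriv (auxH α f) = RatFunc.C (1 / 3) * ∑ i, (2 * (f i * f (i + 1) * f (i + 2)) +
        f i * f (i + 1) * f (i + 3) + f i * f (i + 1) * f (i + 4)) +
      RatFunc.C (1 / 3) * ∑ i, RatFunc.C (-α i + 2 * α (i + 1) - α (i + 2) + α (i + 3) - α (i + 4)) *
        f i := by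
  have c2 : (RatFunc.C (1 / 2) : RatFunc ℂ) = 1 / 2 := by rw [map_div₀, map_one, map_ofNat]
  have c3 : (RatFunc.C (1 / 3) : RatFunc ℂ) = 1 / 3 := by rw [map_div₀, map_one, map_ofNat]
  have c6 : (RatFunc.C (1 / 6) : RatFunc ℂ) = 1 / 6 := by rw [map_div₀, map_one, map_ofNat]
  have r2 : ratDeriv (2 : RatFunc ℂ) = 0 := ratDeriv_ofNat 2
  have r3 : ratDeriv (3 : RatFunc ℂ) = 0 := ratDeriv_ofNat 3
  have r6 : ratDeriv (1 / 6 : RatFunc ℂ) = 0 := by rw [← c6, ratDeriv_C]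
  have o0 := h.ode 0
  have o1 := h.ode 1
  have o2 := h.ode 2
  have o3 := h.ode 3
  have h4 : f 4 = RatFunc.X - f 0 - f 2 := by linear_combination h.sum_even
  have h5 : f 5 = RatFunc.X - f 1 - f 3 := by linear_combination h.sum_odd
  have ha : RatFunc.C (α 5) = 1 - RatFunc.C (α 0) - RatFunc.C (α 1) - RatFunc.C (α 2) -
      RatFunc.C (α 3) - RatFunc.C (α 4) := by
    have := congrArg RatFunc.C h.sum_param
    simp only [map_add, map_one] at this
    linear_combination this
  have e4 := congrArg ratDeriv h4
  have e5 := congrArg ratDeriv h5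
  simp only [ratDeriv_sub, ratDeriv_X] at e4 e5
  simp only [zmod_six_add, zero_add, map_sub, c2] at o0 o1 o2 o3
  have key := deriv_identity RatFunc.X_ne_zero h4 h5 ha e4 e5 o0 o1 o2 o3
  rw [auxH_eq]
  simp only [sum_zmod_six, zmod_six_add, zero_add, map_sub, map_add, map_neg, map_mul, map_ofNat, c3]
  simp only [ratDeriv_add, ratDeriv_sub, ratDeriv_neg, ratDeriv_mul, ratDeriv_C, r2, r3, c6, r6]
  linear_combination key

/-! ### Pole orders at a finite nonzero point -/

theorem coupling_leadAt (h : IsRationalSolution α f) {c : ℂ} {i : ZMod 6} {k : ℤ} {b : ℂ}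
    (hk : LeadAt c k b (f i)) (hk0 : k ≤ 0) :
    LeadAt c (k - 1) (c / 2 * k * b) (f i * coupling RatFunc.X f i) := by
  rw [h.mul_coupling i]
  refine ((((LeadAt.var.mul hk.deriv).const_mul (1 / 2)).congr (l := k - 1) (by ring) rfl rfl).sub
    ((hk.const_mul _).lower (by omega))).sub
    (((LeadAt.var.lower (l := k - 1) (by omega)).sub (hk.lower (by omega))).const_mul _) |>.congr
    rfl (by ring) rfl

/-- Here `r = 1`: differentiation costs one order, and if `f i` vanishes at `c` the right side is
still merely regular, because of the term `α i * t`. -/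
theorem localSystem (h : IsRationalSolution α f) {c : ℂ} (hc : c ≠ 0) :
    LocalSystem c c 1 RatFunc.X f where
  lead := .var
  ne_zero := hc
  sum := h.sum_eq
  bound i k b hk := by
    by_cases hk0 : k ≤ 0
    · exact ⟨_, (h.coupling_leadAt hk hk0).congr (by omega) rfl rfl⟩
    · exact ⟨_, ((LeadAt.var.mul (hk.deriv.lower_le (l := 0) (by omega)).choose_spec).const_mul
        (1 / 2)).sub ((hk.lower (l := 0) (by omega)).const_mul _) |>.sub
        ((LeadAt.var.sub (hk.lower (l := 0) (by omega))).const_mul _) |>.congr (by omega) rfl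
        (h.mul_coupling i).symm⟩

end IsRationalSolution

theorem exists_uniform_leadAt (c : ℂ) (f : ZMod 6 → RatFunc ℂ) :
    ∃ n : ℕ, ∀ i, ∃ b, LeadAt c (-n) b (f i) := by
  have : ∀ i, ∃ k : ℤ, ∃ b, LeadAt c k b (f i) := fun i => by
    by_cases h0 : f i = 0
    · exact ⟨0, 0, by rw [h0]; exact .zero⟩
    · obtain ⟨k, b, -, h⟩ := exists_leadAt c h0
      exact ⟨k, b, h⟩
  choose k b h using this
  refine ⟨∑ i, (k i).natAbs, fun i => (h i).lower_le ?_⟩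
  have := Finset.single_le_sum (f := fun i => (k i).natAbs) (fun _ _ => Nat.zero_le _)
    (Finset.mem_univ i)
  omega

namespace IsRationalSolution

variable {α : ZMod 6 → ℂ} {f : ZMod 6 → RatFunc ℂ}

/-- All poles in `ℂ ∖ {0}` are simple. -/
theorem simple_poles (h : IsRationalSolution α f) {c : ℂ} (hc : c ≠ 0) (i : ZMod 6) :
    ∃ a, LeadAt c (-1) a (f i) := by
  obtain ⟨n, hn⟩ := exists_uniform_leadAt c f
  -- Descent on a common bound for the pole orders. It stops at order one because the lemmas used
  -- need `e ≥ 2`.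
  have step : ∀ n : ℕ, (∀ i, ∃ b, LeadAt c (-(n + 1 : ℕ)) b (f i)) →
      ∀ i, ∃ b, LeadAt c (-1) b (f i) := by
    intro n
    induction n with
    | zero => simp
    | succ n ih =>
      intro hb
      apply ih
      choose a ha using hb
      have hsys : LocalSystem c (2 * (c / 2)) 1 RatFunc.X f := by
        rw [mul_div_cancel₀ c two_ne_zero]; exact h.localSystem hc
      have hE : ∀ i, LeadAt c (-((n + 1 + 1 : ℕ) : ℤ) - 1)
          (-(c / 2 * ((n + 1 + 1 : ℕ) : ℤ) * a i)) (f i * coupling RatFunc.X f i) := fun i =>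
        (h.coupling_leadAt (ha i) (by omega)).congr rfl (by push_cast; ring) rfl
      obtain ⟨z0, z2, z4⟩ := hsys.lead_eq_zero_of_high_order (by omega) ha hE
      obtain ⟨o3, o5, o1⟩ := hsys.opposite (by omega) (by omega) ha
      have hz : ∀ i, a i = 0 := forall_zmod_six z0 (by simp [o1, z4]) z2 (by simp [o3, z0]) z4
        (by simp [o5, z2])
      intro i
      obtain ⟨b, hb⟩ := ((ha i).congr rfl (hz i) rfl).lift
      exact ⟨b, hb.congr (by push_cast; ring) rfl rfl⟩
  exact step n (fun i => (hn i).elim fun b hb => hb.lower_le (by push_cast; omega)) i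

end IsRationalSolution

/-! ### Two-term expansions and the residue of the auxiliary function. -/

/-- `f = a / (t - c) + r + O(t - c)`. -/
def ExpandsAt (c a r : ℂ) (f : RatFunc ℂ) : Prop :=
  ∃ g, HasValueAt c r g ∧ f = RatFunc.C a * (unif c)⁻¹ + g

theorem LeadAt.expandsAt {c a : ℂ} {f : RatFunc ℂ} (h : LeadAt c (-1) a f) :
    ∃ r, ExpandsAt c a r f := by
  obtain ⟨r, hr⟩ := (h.sub ((LeadAt.zpow (c := c) (-1)).const_mul a) |>.congr rfl
    (show _ = 0 by ring) rfl).lift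
  exact ⟨r, _, hr.hasValue, by rw [zpow_neg_one]; ring⟩

theorem ExpandsAt.leadAt {c a r : ℂ} {f : RatFunc ℂ} (h : ExpandsAt c a r f) :
    LeadAt c (-1) a f := by
  obtain ⟨g, hg, rfl⟩ := h
  exact (((LeadAt.zpow (-1)).const_mul a).add ((LeadAt.ofValue hg).lower (by omega))).congr rfl
    (by ring) (by rw [zpow_neg_one])

/-- The triple pole is subtracted explicitly: it cancels only after summation over the indices. -/
theorem ExpandsAt.mul_three {c a b d r s t : ℂ} {f g h : RatFunc ℂ} (hf : ExpandsAt c a r f)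
    (hg : ExpandsAt c b s g) (hh : ExpandsAt c d t h) :
    LeadAt c (-2) (a * b * t + a * s * d + r * b * d)
      (f * g * h - RatFunc.C (a * b * d) * (unif c)⁻¹ ^ 3) := by
  obtain ⟨u, hu, rfl⟩ := hf
  obtain ⟨v, hv, rfl⟩ := hg
  obtain ⟨w, hw, rfl⟩ := hh
  have C := fun r : ℂ => HasValueAt.const (c := c) r
  have h2 := (((C (a * b)).mul hw).add ((C (a * d)).mul hv)).add ((C (b * d)).mul hu)
  have h1 := (((C a).mul (hv.mul hw)).add ((C b).mul (hu.mul hw))).add ((C d).mul (hu.mul hv))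
  have h0 := (hu.mul hv).mul hw
  have y : HasValueAt c 0 (unif c) := .unif_zero
  refine ⟨_, ((h2.add (y.mul h1)).add ((y.mul y).mul h0)).congr' ?_, ?_⟩
  · ring
  · have := unif_ne_zero c
    rw [show (-2 : ℤ) = -(2 : ℕ) from rfl, zpow_neg, zpow_natCast]
    simp only [map_mul]
    field_simp
    ring

/-- A pole of `g` of order above one would survive in `g'` with order above two, since its leading
coefficient is multiplied by a nonzero integer. -/
theorem leadAt_of_ratDeriv {c b : ℂ} {g : RatFunc ℂ} (h : LeadAt c (-2) b (ratDeriv g)) :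
    LeadAt c (-1) (-b) g := by
  by_cases hg : g = 0
  · subst hg
    have h0 : ratDeriv (0 : RatFunc ℂ) = 0 := map_zero ratDerivation
    have : b = 0 := h.unique (by rw [h0]; exact .zero)
    rw [this, neg_zero]
    exact .zero
  · obtain ⟨k, a, ha, hk⟩ := exists_leadAt c hg
    have hd := hk.deriv
    by_cases hk2 : k < -1
    · have := hd.unique (h.lower (l := k - 1) (by omega))
      rw [mul_eq_zero, or_iff_left ha] at this
      have : k = 0 := by exact_mod_cast this
      omega
    · obtain ⟨b', hb'⟩ := hk.lower_le (l := -1) (by omega)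
      have := h.unique (hb'.deriv.congr (l := -2) (by ring) rfl rfl)
      exact hb'.congr rfl (by push_cast at this; linear_combination this) rfl

namespace IsRationalSolution

variable {α : ZMod 6 → ℂ} {f : ZMod 6 → RatFunc ℂ} {c : ℂ} {a r : ZMod 6 → ℂ}

theorem coupling_expansion (hf : ∀ i, ExpandsAt c (a i) (r i) (f i)) (i : ZMod 6) :
    ∃ W V v, HasValueAt c (a (i + 2) * (2 * r (i + 1) - c) + r (i + 2) * (2 * a (i + 1)) -
        (a (i + 4) * (2 * r (i + 5) - c) + r (i + 4) * (2 * a (i + 5)))) W ∧ HasValueAt c v V ∧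
      coupling RatFunc.X f i =
        RatFunc.C (a (i + 2) * (2 * a (i + 1)) - a (i + 4) * (2 * a (i + 5))) * (unif c)⁻¹ ^ 2 +
        W * (unif c)⁻¹ + V := by
  obtain ⟨g1, h1, e1⟩ := hf (i + 1)
  obtain ⟨g2, h2, e2⟩ := hf (i + 2)
  obtain ⟨g4, h4, e4⟩ := hf (i + 4)
  obtain ⟨g5, h5, e5⟩ := hf (i + 5)
  have C := fun r : ℂ => HasValueAt.const (c := c) r
  have T : HasValueAt c c RatFunc.X := .var
  have sub : ∀ {u v : RatFunc ℂ} {x y : ℂ}, HasValueAt c x u → HasValueAt c y v →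
      HasValueAt c (x - y) (u - v) := fun hu hv =>
    (LeadAt.sub (.ofValue hu) (.ofValue hv)).hasValue
  have hc2 : (RatFunc.C 2 : RatFunc ℂ) = 2 := map_ofNat _ 2
  refine ⟨_, _, _, sub (((C (a (i + 2))).mul (sub ((C 2).mul h1) T)).add (h2.mul (C (2 * a (i + 1)))))
      (((C (a (i + 4))).mul (sub ((C 2).mul h5) T)).add (h4.mul (C (2 * a (i + 5))))),
    sub (h2.mul (sub ((C 2).mul h1) T)) (h4.mul (sub ((C 2).mul h5) T)), ?_⟩
  rw [coupling, e1, e2, e4, e5]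
  simp only [map_sub, map_mul, hc2]
  ring

/-- Comparison of coefficients in `mul_coupling`: order `-3` gives the cubic relation and order `-2`
the quadratic one. When `f i` is regular and its coupling has no double pole, order `-1` gives the
linear one. -/
theorem poleData (h : IsRationalSolution α f) (hc : c ≠ 0)
    (hf : ∀ i, ExpandsAt c (a i) (r i) (f i)) : PoleData c a r := by
  have ha : ∀ i, LeadAt c (-1) (a i) (f i) := fun i => (hf i).leadAt
  have hE := fun i => (h.coupling_leadAt (ha i) (by omega)).congr
    (show (-1 - 1 : ℤ) = -2 by norm_num) rfl rfl
  have hsum := (h.localSystem hc).sum_lead le_rfl ha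
  have hcubic := (h.localSystem hc).cubic_lead le_rfl (by omega) ha
  have hy := unif_ne_zero c
  have y : HasValueAt c 0 (unif c) := .unif_zero
  refine ⟨hc, hsum, fun i => ?_, hcubic, fun i => ?_, fun i ha0 hq0 => ?_⟩
  · obtain ⟨g, hg, e⟩ := hf i
    obtain ⟨g', hg', e'⟩ := hf (i + 2)
    obtain ⟨g'', hg'', e''⟩ := hf (i + 4)
    refine ((hg.add hg').add hg'').unique ?_
    have h1 := h.sum_eq i
    rw [e, e', e''] at h1
    have h2 := congrArg RatFunc.C (hsum i)
    simp only [map_add, map_zero] at h2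
    have h3 : g + g' + g'' = RatFunc.X := by linear_combination h1 - (unif c)⁻¹ * h2
    rw [h3]
    exact .var
  · obtain ⟨g, hg, e⟩ := hf i
    obtain ⟨W, V, v, hW, hV, hWV⟩ := coupling_expansion hf i
    have h2 := congrArg RatFunc.C (hcubic i)
    set q := a (i + 2) * (2 * a (i + 1)) - a (i + 4) * (2 * a (i + 5)) with hq
    have C := fun r : ℂ => HasValueAt.const (c := c) r
    have hR := (((C (a i)).mul hW).add (hg.mul (C q))).add
      ((y.mul (((C (a i)).mul hV).add (hg.mul hW))).add ((y.mul y).mul (hg.mul hV)))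
    have hL : LeadAt c (-2) _ (f i * coupling RatFunc.X f i) := ⟨_, hR, by
      rw [hWV, e, show (-2 : ℤ) = -(2 : ℕ) from rfl, zpow_neg, zpow_natCast]
      rw [map_mul, map_zero] at h2
      field_simp
      linear_combination h2⟩
    have := hL.unique (hE i)
    push_cast at this
    linear_combination this
  · obtain ⟨g, hg, e⟩ := hf i
    obtain ⟨W, V, v, hW, hV, hWV⟩ := coupling_expansion hf i
    have hR := (hg.mul hW).add (y.mul (hg.mul hV))
    rw [ha0, map_zero, zero_mul, zero_add] at e
    rw [hq0, map_zero, zero_mul, zero_add] at hWV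
    have hL : LeadAt c (-1) _ (f i * coupling RatFunc.X f i) := ⟨_, hR, by
      rw [hWV, e, zpow_neg_one]
      field_simp⟩
    have hE' := (h.coupling_leadAt (k := 0) (b := r i) (i := i)
      (.ofValue (by rw [e]; exact hg)) le_rfl).congr (show (0 - 1 : ℤ) = -1 by norm_num) rfl rfl
    have := hL.unique hE'
    push_cast at this
    linear_combination this

/-- The auxiliary function has at most simple poles in `ℂ ∖ {0}`, with residue at `c` a natural
multiple of `c / 12` which vanishes only where all `f i` are regular. -/
theorem auxH_leadAt (h : IsRationalSolution α f) (hc : c ≠ 0) :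
    ∃ m : ℕ, (m = 0 → ∀ i, ¬ HasPoleAt (f i) c) ∧ LeadAt c (-1) (m * (c / 12)) (auxH α f) := by
  choose a ha using h.simple_poles hc
  choose r hf using fun i => (ha i).expandsAt
  obtain ⟨h0, m, hm, hres⟩ := (h.poleData hc hf).residueLaw
  refine ⟨m, fun hm0 i => ?_, ?_⟩
  · rw [not_hasPoleAt_iff]
    exact ((ha i).congr rfl (hm hm0 i) rfl).lift
  · have hlin : LeadAt c (-2) 0 (RatFunc.C (1 / 3) * ∑ i,
        RatFunc.C (-α i + 2 * α (i + 1) - α (i + 2) + α (i + 3) - α (i + 4)) * f i) := by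
      have hi : ∀ i, LeadAt c (-2) 0
        (RatFunc.C (-α i + 2 * α (i + 1) - α (i + 2) + α (i + 3) - α (i + 4)) * f i) := fun i =>
        ((ha i).lower (l := -2) (by omega)).const_mul _ |>.congr rfl (by ring) rfl
      rw [sum_zmod_six]
      exact (((((((hi 0).add (hi 1)).add (hi 2)).add (hi 3)).add (hi 4)).add (hi 5)).const_mul
        (1 / 3)).congr rfl (by ring) rfl
    have hi := fun i => ((((hf i).mul_three (hf (i + 1)) (hf (i + 2))).const_mul 2).add
      ((hf i).mul_three (hf (i + 1)) (hf (i + 3)))).add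
      ((hf i).mul_three (hf (i + 1)) (hf (i + 4)))
    have hsum := ((((((hi 0).add (hi 1)).add (hi 2)).add (hi 3)).add (hi 4)).add (hi 5)).const_mul
        (1 / 3)
    refine (leadAt_of_ratDeriv ((hsum.add hlin).congr rfl rfl ?_)).congr rfl ?_ rfl
    · rw [h.deriv_auxH]
      have h0' := congrArg RatFunc.C h0
      have hc2 : (RatFunc.C 2 : RatFunc ℂ) = 2 := map_ofNat _ 2
      simp only [sum_zmod_six, map_add, map_mul, hc2, map_zero] at h0' ⊢
      linear_combination -(RatFunc.C (1 / 3) * (unif c)⁻¹ ^ 3) * h0'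
    · simp only [sum_zmod_six] at hres
      linear_combination hres / 12

end IsRationalSolution

end PainleveA5

/-! ### Algebra of the values at infinity. -/

namespace PainleveA5

/-- The diagonal entry of the linearization at a vanishing component is nonzero. Otherwise, `p2 = 0`
forces `p5 = 1/2` against `e5`, `p4 = 0` forces `p1 = 1/2` against `e1`, and the remaining case
forces `p3 = p2 = p4 = 1/2` and `p1 = p5 = 1/4`, against `e1`. -/
theorem coupling_ne_zero_of_fixed {p0 p1 p2 p3 p4 p5 : ℂ} (hs : p0 + p2 + p4 = 1)
    (hs' : p1 + p3 + p5 = 1)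
    (e1 : p1 * (p3 * (2 * p2 - 1) - p5 * (2 * p0 - 1)) = 0)
    (e2 : p2 * (p4 * (2 * p3 - 1) - p0 * (2 * p1 - 1)) = 0)
    (e3 : p3 * (p5 * (2 * p4 - 1) - p1 * (2 * p2 - 1)) = 0)
    (e5 : p5 * (p1 * (2 * p0 - 1) - p3 * (2 * p4 - 1)) = 0)
    (h0 : p0 = 0) : p2 * (2 * p1 - 1) - p4 * (2 * p5 - 1) ≠ 0 := by
  intro e0
  subst h0
  have h4 : p4 = 1 - p2 := by linear_combination hs
  subst h4
  by_cases h2 : p2 = 0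
  · grind
  by_cases h4 : 1 - p2 = 0
  · grind
  have h3 : 2 * p3 - 1 = 0 := by
    have : p2 * (1 - p2) * (2 * p3 - 1) = 0 := by linear_combination e2
    simpa [h2, h4] using this
  grind

-- Every admissible value at infinity is a nondegenerate zero of the cubic system on the hyperplanes
-- of fixed sums. The check runs over the patterns of vanishing components.
set_option maxHeartbeats 1000000 in
theorem linearization_injective {p0 p1 p2 p3 p4 p5 g0 g1 g2 g3 g4 g5 : ℂ} (hs : p0 + p2 + p4 = 1)
    (hs' : p1 + p3 + p5 = 1) (hg : g0 + g2 + g4 = 0) (hg' : g1 + g3 + g5 = 0)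
    (e0 : p0 * (p2 * (2 * p1 - 1) - p4 * (2 * p5 - 1)) = 0)
    (e1 : p1 * (p3 * (2 * p2 - 1) - p5 * (2 * p0 - 1)) = 0)
    (e2 : p2 * (p4 * (2 * p3 - 1) - p0 * (2 * p1 - 1)) = 0)
    (e3 : p3 * (p5 * (2 * p4 - 1) - p1 * (2 * p2 - 1)) = 0)
    (z0 : p0 = 0 → g0 = 0) (z1 : p1 = 0 → g1 = 0) (z2 : p2 = 0 → g2 = 0) (z3 : p3 = 0 → g3 = 0)
    (z4 : p4 = 0 → g4 = 0) (z5 : p5 = 0 → g5 = 0)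
    (l0 : p0 ≠ 0 → g2 * (2 * p1 - 1) + p2 * (2 * g1) - g4 * (2 * p5 - 1) - p4 * (2 * g5) = 0)
    (l1 : p1 ≠ 0 → g3 * (2 * p2 - 1) + p3 * (2 * g2) - g5 * (2 * p0 - 1) - p5 * (2 * g0) = 0)
    (l2 : p2 ≠ 0 → g4 * (2 * p3 - 1) + p4 * (2 * g3) - g0 * (2 * p1 - 1) - p0 * (2 * g1) = 0)
    (l3 : p3 ≠ 0 → g5 * (2 * p4 - 1) + p5 * (2 * g4) - g1 * (2 * p2 - 1) - p1 * (2 * g2) = 0)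
    (l4 : p4 ≠ 0 → g0 * (2 * p5 - 1) + p0 * (2 * g5) - g2 * (2 * p3 - 1) - p2 * (2 * g3) = 0)
    (l5 : p5 ≠ 0 → g1 * (2 * p0 - 1) + p1 * (2 * g0) - g3 * (2 * p4 - 1) - p3 * (2 * g4) = 0) :
    g0 = 0 ∧ g2 = 0 ∧ g4 = 0 ∧ g1 = 0 ∧ g3 = 0 ∧ g5 = 0 := by
  by_cases h0 : p0 = 0 <;> by_cases h1 : p1 = 0 <;> by_cases h2 : p2 = 0 <;>
    by_cases h3 : p3 = 0 <;> by_cases h4 : p4 = 0 <;> by_cases h5 : p5 = 0 <;> grind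

/-! ### Substitutions -/

/-- The substitution `t ↦ g` for a transcendental `g`. -/
noncomputable def substitution (g : RatFunc ℂ) (hg : Transcendental ℂ g) :
    RatFunc ℂ →ₐ[ℂ] RatFunc ℂ :=
  RatFunc.liftAlgHom (Polynomial.aeval g) (nonZeroDivisors_le_comap_nonZeroDivisors_of_injective _
    (transcendental_iff_injective.1 hg))

theorem substitution_algebraMap (g : RatFunc ℂ) (hg : Transcendental ℂ g) (p : Polynomial ℂ) :
    substitution g hg (algebraMap _ _ p) = Polynomial.aeval g p := by
  have := RatFunc.liftAlgHom_apply_div (Polynomial.aeval g)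
    (nonZeroDivisors_le_comap_nonZeroDivisors_of_injective _ (transcendental_iff_injective.1 hg)) p 1
  simpa [substitution] using this

theorem substitution_X (g : RatFunc ℂ) (hg : Transcendental ℂ g) :
    substitution g hg RatFunc.X = g := by
  rw [← RatFunc.algebraMap_X, substitution_algebraMap, Polynomial.aeval_X]

theorem substitution_C (g : RatFunc ℂ) (hg : Transcendental ℂ g) (r : ℂ) :
    substitution g hg (RatFunc.C r) = RatFunc.C r := by
  rw [← RatFunc.algebraMap_C, substitution_algebraMap, Polynomial.aeval_C, RatFunc.algebraMap_C]
  rfl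

theorem transcendental_inv_X : Transcendental ℂ (RatFunc.X⁻¹ : RatFunc ℂ) := fun h =>
  RatFunc.transcendental_X (by simpa using h.inv)

theorem transcendental_neg_X : Transcendental ℂ (-RatFunc.X : RatFunc ℂ) := fun h =>
  RatFunc.transcendental_X (by simpa using h.neg)

/-- The substitution `t ↦ 1 / t`. -/
noncomputable def reciprocal : RatFunc ℂ →ₐ[ℂ] RatFunc ℂ :=
  substitution RatFunc.X⁻¹ transcendental_inv_X

/-- The substitution `t ↦ -t`. -/
noncomputable def reflection : RatFunc ℂ →ₐ[ℂ] RatFunc ℂ :=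
  substitution (-RatFunc.X) transcendental_neg_X

theorem reciprocal_X : reciprocal RatFunc.X = RatFunc.X⁻¹ := substitution_X _ _
theorem reciprocal_C (r : ℂ) : reciprocal (RatFunc.C r) = RatFunc.C r := substitution_C _ _ r
theorem reflection_X : reflection RatFunc.X = -RatFunc.X := substitution_X _ _
theorem reflection_C (r : ℂ) : reflection (RatFunc.C r) = RatFunc.C r := substitution_C _ _ r

/-- Identifies the evaluation in `constTermInfty` with a field homomorphism, so that it is
compatible with sums and products. -/
theorem eval_inv_X_eq (g : RatFunc ℂ) :
    RatFunc.eval RatFunc.C (RatFunc.X)⁻¹ g = reciprocal g := by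
  rw [reciprocal, substitution, RatFunc.liftAlgHom_apply, RatFunc.eval]
  rfl

theorem LeadAt.reflection {c a : ℂ} {k : ℤ} {f : RatFunc ℂ} (h : LeadAt c k a f) :
    LeadAt (-c) k ((-1) ^ k * a) (PainleveA5.reflection f) := by
  have hv : ∀ {a : ℂ} {u : RatFunc ℂ}, HasValueAt c a u →
      HasValueAt (-c) a (PainleveA5.reflection u) := by
    rintro a u ⟨p, q, hq, hp, h⟩
    have hr : ∀ p : Polynomial ℂ, PainleveA5.reflection (algebraMap _ _ p) =
        algebraMap _ _ (p.comp (-Polynomial.X)) := fun p => by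
      rw [show p.comp (-Polynomial.X) = Polynomial.aeval (-Polynomial.X : Polynomial ℂ) p from rfl,
        PainleveA5.reflection, substitution_algebraMap, ← Polynomial.aeval_algebraMap_apply]
      simp
    exact ⟨p.comp (-Polynomial.X), q.comp (-Polynomial.X), by simpa using hq, by simpa using hp, by
      rw [← hr, ← hr, ← h, map_mul]⟩
  obtain ⟨u, hu, rfl⟩ := h
  have h1 := (HasValueAt.const ((-1) ^ k)).mul (hv hu)
  refine ⟨_, h1, ?_⟩
  have : PainleveA5.reflection (unif c) = -1 * unif (-c) := by
    simp only [unif, map_sub, reflection_X, reflection_C, map_neg]; ring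
  rw [map_mul, map_zpow₀, this, mul_zpow, map_zpow₀, map_neg, map_one]
  ring

/-! ### Regularity and rigidity at infinity. -/

/-- The equation satisfied by the functions `f i / t` in the variable `1 / t`. -/
structure ReciprocalSystem (α : ZMod 6 → ℂ) (φ : ZMod 6 → RatFunc ℂ) : Prop where
  sum : ∀ i, φ i + φ (i + 2) + φ (i + 4) = 1
  eqn : ∀ i, φ i * coupling 1 φ i = RatFunc.X ^ 2 *
    (RatFunc.C (1 / 2) * (φ i - RatFunc.X * ratDeriv (φ i)) -
      RatFunc.C (1 / 2 - α (i + 2) - α (i + 4)) * φ i - RatFunc.C (α i) * (1 - φ i))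

theorem IsRationalSolution.reciprocalSystem {α : ZMod 6 → ℂ} {f : ZMod 6 → RatFunc ℂ}
    (h : IsRationalSolution α f) :
    ReciprocalSystem α (fun i => RatFunc.X * reciprocal (f i)) where
  sum i := by
    have := congrArg reciprocal (h.sum_eq i)
    rw [map_add, map_add, reciprocal_X] at this
    have hX : (RatFunc.X : RatFunc ℂ) ≠ 0 := RatFunc.X_ne_zero
    rw [← mul_add, ← mul_add, this, mul_inv_cancel₀ hX]
  eqn i := by
    have hX : (RatFunc.X : RatFunc ℂ) ≠ 0 := RatFunc.X_ne_zero
    have hd : ratDeriv (reciprocal (f i)) = -(reciprocal (ratDeriv (f i))) * RatFunc.X⁻¹ ^ 2 := by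
      rw [ratDeriv_map, reciprocal_X, ← zpow_neg_one, ratDeriv_zpow _ hX, ratDeriv_X]
      rw [show (-1 - 1 : ℤ) = -(2 : ℕ) from rfl, zpow_neg, zpow_natCast, zpow_neg_one]
      push_cast
      ring
    have := congrArg reciprocal (h.mul_coupling i)
    simp only [coupling, map_mul, map_sub, reciprocal_X, reciprocal_C, map_ofNat] at this
    simp only [coupling, ratDeriv_mul, ratDeriv_X, hd, map_sub]
    field_simp at this ⊢
    linear_combination this

namespace ReciprocalSystem

variable {α : ZMod 6 → ℂ} {φ ψ : ZMod 6 → RatFunc ℂ}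

theorem leadAt_X : LeadAt 0 1 1 (RatFunc.X : RatFunc ℂ) :=
  (LeadAt.zpow (c := 0) 1).congr rfl rfl (by simp [unif])

theorem leadAt_one : LeadAt 0 0 1 (1 : RatFunc ℂ) :=
  (LeadAt.const 1).congr rfl rfl (map_one _)

theorem coupling_leadAt (h : ReciprocalSystem α φ) {i : ZMod 6} {k : ℤ} {b : ℂ}
    (hk : LeadAt 0 k b (φ i)) : ∃ b', LeadAt 0 (min k 0 + 2) b' (φ i * coupling 1 φ i) := by
  rw [h.eqn i]
  obtain ⟨b', hb'⟩ := hk.lower_le (min_le_left k 0)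
  obtain ⟨d, hd⟩ := (leadAt_X.mul hk.deriv).lower_le (l := min k 0) (by omega)
  obtain ⟨e, he⟩ := leadAt_one.lower_le (min_le_right k 0)
  have := (((hb'.sub hd).const_mul (1 / 2)).sub
    (hb'.const_mul (1 / 2 - α (i + 2) - α (i + 4)))).sub ((he.sub hb').const_mul (α i))
  exact ⟨_, ((leadAt_X.mul leadAt_X).mul this).congr (by ring) rfl (by ring)⟩

/-- The factor `RatFunc.X ^ 2` gains two orders; `r = -1` records only what the elimination of poles
needs, and lets it reach simple poles as well. -/
theorem localSystem (h : ReciprocalSystem α φ) : LocalSystem 0 1 (-1) 1 φ where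
  lead := leadAt_one
  ne_zero := one_ne_zero
  sum := h.sum
  bound i k b hk := by
    obtain ⟨b', hb'⟩ := h.coupling_leadAt hk
    exact hb'.lower_le (by omega)

theorem regular (h : ReciprocalSystem α φ) (i : ZMod 6) : ∃ p, LeadAt 0 0 p (φ i) := by
  obtain ⟨n, hn⟩ := exists_uniform_leadAt 0 φ
  have step : ∀ n : ℕ, (∀ i, ∃ b, LeadAt 0 (-n) b (φ i)) → ∀ i, ∃ b, LeadAt 0 0 b (φ i) := by
    intro n
    induction n with
    | zero => simp
    | succ n ih =>
      intro hb
      apply ih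
      choose a ha using hb
      obtain ⟨z0, z2, z4⟩ := h.localSystem.lead_eq_zero_of_neg_one (by omega) ha
      obtain ⟨o3, o5, o1⟩ := h.localSystem.opposite (by omega) (by omega) ha
      have hz : ∀ i, a i = 0 := forall_zmod_six z0 (by simp [o1, z4]) z2 (by simp [o3, z0]) z4
        (by simp [o5, z2])
      intro i
      obtain ⟨b, hb⟩ := ((ha i).congr rfl (hz i) rfl).lift
      exact ⟨b, hb.congr (by push_cast; ring) rfl rfl⟩
  exact step n hn i

variable {p : ZMod 6 → ℂ}

theorem coupling_value (hp : ∀ i, LeadAt 0 0 (p i) (φ i)) (i : ZMod 6) :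
    LeadAt 0 0 (p (i + 2) * (2 * p (i + 1) - 1) - p (i + 4) * (2 * p (i + 5) - 1))
      (coupling 1 φ i) :=
  ((hp _).mul ((hp _).two_mul.sub leadAt_one)).sub ((hp _).mul ((hp _).two_mul.sub leadAt_one))

theorem fixed (h : ReciprocalSystem α φ) (hp : ∀ i, LeadAt 0 0 (p i) (φ i)) (i : ZMod 6) :
    p i * (p (i + 2) * (2 * p (i + 1) - 1) - p (i + 4) * (2 * p (i + 5) - 1)) = 0 := by
  obtain ⟨b, hb⟩ := h.coupling_leadAt (hp i)
  exact ((hp i).mul (coupling_value hp i)).unique (hb.lower (by norm_num))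

theorem sum_value (h : ReciprocalSystem α φ) (hp : ∀ i, LeadAt 0 0 (p i) (φ i)) (i : ZMod 6) :
    p i + p (i + 2) + p (i + 4) = 1 :=
  (((hp i).add (hp (i + 2))).add (hp (i + 4))).unique (leadAt_one.congr rfl rfl (h.sum i).symm)

/-- The right sides differ at order `n + 2`, so at order `n` the derivative plays no role and only
the linearized cubic map remains. -/
theorem linearized (h : ReciprocalSystem α φ) (h' : ReciprocalSystem α ψ)
    (hp : ∀ i, LeadAt 0 0 (p i) (φ i)) (hp' : ∀ i, LeadAt 0 0 (p i) (ψ i)) {n : ℤ}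
    {γ : ZMod 6 → ℂ} (hγ : ∀ i, LeadAt 0 n (γ i) (φ i - ψ i)) (i : ZMod 6) :
    γ i * (p (i + 2) * (2 * p (i + 1) - 1) - p (i + 4) * (2 * p (i + 5) - 1)) +
      p i * (γ (i + 2) * (2 * p (i + 1) - 1) + p (i + 2) * (2 * γ (i + 1)) -
        γ (i + 4) * (2 * p (i + 5) - 1) - p (i + 4) * (2 * γ (i + 5))) = 0 := by
  have hL : LeadAt 0 n _ (φ i * coupling 1 φ i - ψ i * coupling 1 ψ i) :=
    (((hγ i).mul (coupling_value hp i)).congr (add_zero n) rfl rfl).add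
      (((hp' i).mul (((((hγ (i + 2)).mul ((hp (i + 1)).two_mul.sub leadAt_one)).congr (add_zero n)
        rfl rfl).add (((hp' (i + 2)).mul (hγ (i + 1)).two_mul).congr (zero_add n) rfl rfl)).sub
        (((hγ (i + 4)).mul ((hp (i + 5)).two_mul.sub leadAt_one)).congr (add_zero n) rfl rfl) |>.sub
        (((hp' (i + 4)).mul (hγ (i + 5)).two_mul).congr (zero_add n) rfl rfl))).congr (zero_add n)
        rfl rfl) |>.congr rfl rfl (by simp only [coupling]; ring)
  refine hL.unique ?_
  have hR := (((hγ i).sub ((leadAt_X.mul (hγ i).deriv).congr (l := n) (by ring) rfl rfl)).const_mul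
    (1 / 2)).sub ((hγ i).const_mul (1 / 2 - α (i + 2) - α (i + 4))) |>.add ((hγ i).const_mul (α i))
  refine LeadAt.lower (k := 1 + 1 + n) (((leadAt_X.mul leadAt_X).mul hR).congr rfl rfl ?_) (by omega)
  rw [h.eqn, h'.eqn, ratDeriv_sub]
  ring

/-- A solution is determined by its value at infinity. -/
theorem unique (h : ReciprocalSystem α φ) (h' : ReciprocalSystem α ψ)
    (hp : ∀ i, LeadAt 0 0 (p i) (φ i)) (hp' : ∀ i, LeadAt 0 0 (p i) (ψ i)) : φ = ψ := by
  have s0 := h.sum_value hp 0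
  have s1 := h.sum_value hp 1
  have hfix := h.fixed hp
  have hne : ∀ i, p i = 0 →
      p (i + 2) * (2 * p (i + 1) - 1) - p (i + 4) * (2 * p (i + 5) - 1) ≠ 0 := by
    intro i
    have e : ∀ j k : ZMod 6, i + j + k = i + (j + k) := fun j k => add_assoc i j k
    have t0 := h.sum_value hp i
    have t1 := h.sum_value hp (i + 1)
    have f1 := hfix (i + 1)
    have f2 := hfix (i + 2)
    have f3 := hfix (i + 3)
    have f5 := hfix (i + 5)
    simp only [e, zmod_six_add, add_zero] at t1 f1 f2 f3 f5
    exact coupling_ne_zero_of_fixed t0 t1 f1 f2 f3 f5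
  -- The leading coefficients of the difference lie in the kernel of an injective linear map, so the
  -- solutions agree to every order.
  have key : ∀ n : ℕ, ∀ i, ∃ b, LeadAt 0 n b (φ i - ψ i) := by
    intro n
    induction n with
    | zero => exact fun i => ⟨_, (hp i).sub (hp' i)⟩
    | succ n ih =>
      choose γ hγ using ih
      have hlin := h.linearized h' hp hp' hγ
      have hz : ∀ i, p i = 0 → γ i = 0 := fun i hi => by
        have := hlin i
        rw [hi, zero_mul, add_zero] at this
        exact (mul_eq_zero.1 this).resolve_right (hne i hi)
      have hl : ∀ i, p i ≠ 0 → γ (i + 2) * (2 * p (i + 1) - 1) + p (i + 2) * (2 * γ (i + 1)) -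
          γ (i + 4) * (2 * p (i + 5) - 1) - p (i + 4) * (2 * γ (i + 5)) = 0 := fun i hi => by
        have h1 := hlin i
        have h2 := (mul_eq_zero.1 (hfix i)).resolve_left hi
        rw [h2, mul_zero, zero_add] at h1
        exact (mul_eq_zero.1 h1).resolve_left hi
      have hg : ∀ i, γ i + γ (i + 2) + γ (i + 4) = 0 := fun i =>
        (((hγ i).add (hγ (i + 2))).add (hγ (i + 4))).unique
          (LeadAt.zero.congr rfl rfl (by linear_combination h'.sum i - h.sum i))
      obtain ⟨z0, z2, z4, z1, z3, z5⟩ := linearization_injective s0 s1 (hg 0) (hg 1) (hfix 0)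
        (hfix 1) (hfix 2) (hfix 3) (hz 0) (hz 1) (hz 2) (hz 3) (hz 4) (hz 5) (hl 0) (hl 1) (hl 2)
        (hl 3) (hl 4) (hl 5)
      have hzero : ∀ i, γ i = 0 := forall_zmod_six z0 z1 z2 z3 z4 z5
      intro i
      obtain ⟨b, hb⟩ := ((hγ i).congr rfl (hzero i) rfl).lift
      exact ⟨b, hb.congr (by push_cast; ring) rfl rfl⟩
  funext i
  by_contra hne
  obtain ⟨k, a, ha, hk⟩ := exists_leadAt 0 (sub_ne_zero.2 hne)
  obtain ⟨b, hb⟩ := key (k.toNat + 1) i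
  exact ha (hk.unique (hb.lower (by omega)))

end ReciprocalSystem

/-! ### Oddness of rational solutions. -/

theorem IsRationalSolution.neg_reflection {α : ZMod 6 → ℂ} {f : ZMod 6 → RatFunc ℂ}
    (h : IsRationalSolution α f) : IsRationalSolution α (fun i => -reflection (f i)) where
  ode i := by
    have hd : ratDeriv (-reflection (f i)) = reflection (ratDeriv (f i)) := by
      rw [ratDeriv_neg, ratDeriv_map, reflection_X, ratDeriv_neg, ratDeriv_X]
      ring
    have := congrArg reflection (h.ode i)
    simp only [map_mul, map_add, map_sub, map_div₀, map_one, map_ofNat, reflection_X,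
      reflection_C] at this
    rw [hd]
    simp only [map_sub, map_div₀, map_one, map_ofNat]
    linear_combination -this
  sum_even := by
    have := congrArg reflection h.sum_even
    simp only [map_add, reflection_X] at this
    linear_combination -this
  sum_odd := by
    have := congrArg reflection h.sum_odd
    simp only [map_add, reflection_X] at this
    linear_combination -this
  sum_param := h.sum_param

theorem reciprocal_reflection (g : RatFunc ℂ) :
    reciprocal (reflection g) = reflection (reciprocal g) := by
  have hpoly : ∀ p : Polynomial ℂ, reciprocal (reflection (algebraMap _ _ p)) =
      reflection (reciprocal (algebraMap _ _ p)) := fun p => by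
    rw [reflection, substitution_algebraMap, ← reflection, ← Polynomial.aeval_algHom_apply,
      reciprocal, substitution_algebraMap, ← reciprocal, ← Polynomial.aeval_algHom_apply,
      map_neg, reciprocal_X, map_inv₀, reflection_X, show (-RatFunc.X : RatFunc ℂ)⁻¹ =
        -RatFunc.X⁻¹ by have := RatFunc.X_ne_zero (K := ℂ); field_simp]
  rw [← RatFunc.num_div_denom g]
  simp only [map_div₀, hpoly]

theorem reciprocal_injective : Function.Injective reciprocal := reciprocal.toRingHom.injective

/-- Every rational solution is odd. -/
theorem IsRationalSolution.reflection_eq {α : ZMod 6 → ℂ} {f : ZMod 6 → RatFunc ℂ}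
    (h : IsRationalSolution α f) (i : ZMod 6) : reflection (f i) = -f i := by
  have h1 := h.reciprocalSystem
  have h2 := h.neg_reflection.reciprocalSystem
  choose p hp using h1.regular
  -- Dividing `-f(-t)` by `t` gives `f(-t) / (-t)`, which has the same value at infinity as `f(t) /
  -- t`.
  have hp' : ∀ i, LeadAt 0 0 (p i) (RatFunc.X * reciprocal (-reflection (f i))) := fun i => by
    have h3 := (hp i).reflection
    rwa [neg_zero, zpow_zero, one_mul, map_mul, reflection_X, ← reciprocal_reflection, neg_mul,
      ← mul_neg, ← map_neg] at h3
  have h4 : RatFunc.X * reciprocal (f i) = RatFunc.X * reciprocal (-reflection (f i)) :=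
    congrFun (h1.unique h2 hp hp') i
  have h5 := reciprocal_injective (mul_left_cancel₀ RatFunc.X_ne_zero h4)
  rw [eq_neg_iff_add_eq_zero]
  linear_combination h5

open Polynomial

theorem IsRationalSolution.reflection_auxH {α : ZMod 6 → ℂ} {f : ZMod 6 → RatFunc ℂ}
    (h : IsRationalSolution α f) : reflection (auxH α f) = auxH α f := by
  simp only [auxH_eq, sum_zmod_six, map_mul, map_add, map_sub, map_neg, map_ofNat, reflection_C,
    h.reflection_eq]
  ring

/-! ### Constant terms -/

theorem coe_algebraMap_polynomial (p : ℂ[X]) :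
    ((algebraMap ℂ[X] (RatFunc ℂ) p : RatFunc ℂ) : LaurentSeries ℂ) =
      HahnSeries.ofPowerSeries ℤ ℂ (p : PowerSeries ℂ) := by
  rw [RatFunc.coe_coe, RatFunc.coePolynomial_eq_algebraMap]

theorem constTermZero_add (g h : RatFunc ℂ) :
    constTermZero (g + h) = constTermZero g + constTermZero h := by
  simp only [constTermZero, map_add, HahnSeries.coeff_add]

theorem constTermZero_const_mul (a : ℂ) (g : RatFunc ℂ) :
    constTermZero (RatFunc.C a * g) = a * constTermZero g := by
  rw [constTermZero, map_mul, ← RatFunc.algebraMap_C, coe_algebraMap_polynomial,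
    Polynomial.coe_C, HahnSeries.ofPowerSeries_C, HahnSeries.C_mul_eq_smul, HahnSeries.coeff_smul,
    smul_eq_mul, constTermZero]

theorem constTermZero_of_hasValueAt {a : ℂ} {u : RatFunc ℂ} (h : HasValueAt 0 a u) :
    constTermZero u = a := by
  obtain ⟨p, q, hq, hp, h⟩ := h
  rw [← coeff_zero_eq_eval_zero] at hq hp
  rw [← coeff_zero_eq_eval_zero] at hp
  have hq' : PowerSeries.constantCoeff (q : PowerSeries ℂ) ≠ 0 := by
    simpa using hq
  have h1 := congrArg (fun g : RatFunc ℂ => (g : LaurentSeries ℂ)) h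
  simp only [map_mul, coe_algebraMap_polynomial] at h1
  have h2 : (u : LaurentSeries ℂ) =
      HahnSeries.ofPowerSeries ℤ ℂ ((p : PowerSeries ℂ) * (q : PowerSeries ℂ)⁻¹) := by
    rw [map_mul, ← h1, mul_assoc, ← map_mul, PowerSeries.mul_inv_cancel _ hq', map_one, mul_one]
  have h3 := HahnSeries.ofPowerSeries_apply_coeff (Γ := ℤ)
    ((p : PowerSeries ℂ) * (q : PowerSeries ℂ)⁻¹) 0
  rw [Nat.cast_zero] at h3
  rw [constTermZero, h2, h3, PowerSeries.coeff_zero_eq_constantCoeff_apply, map_mul,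
    PowerSeries.constantCoeff_inv]
  simp only [Polynomial.constantCoeff_coe]
  rw [hp]
  field_simp

theorem constTermZero_X_zpow (k : ℤ) :
    constTermZero (RatFunc.X ^ k) = if k = 0 then 1 else 0 := by
  rw [constTermZero, map_zpow₀, RatFunc.coe_X, ← RatFunc.single_zpow, HahnSeries.coeff_single]
  simp only [eq_comm]

/-- The difference of the constant terms at `0` and `∞`. -/
noncomputable def constDiff : RatFunc ℂ →+ ℂ :=
  AddMonoidHom.mk' (fun g => constTermZero g - constTermInfty g) fun g h => by
    simp only [constTermInfty, eval_inv_X_eq, map_add, constTermZero_add]; ring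

theorem constDiff_apply (g : RatFunc ℂ) :
    constDiff g = constTermZero g - constTermZero (reciprocal g) := by
  rw [← eval_inv_X_eq]; rfl

theorem constDiff_C_mul (a : ℂ) (g : RatFunc ℂ) :
    constDiff (RatFunc.C a * g) = a * constDiff g := by
  simp only [constDiff_apply, map_mul, reciprocal_C, constTermZero_const_mul]; ring

theorem constDiff_X_zpow (k : ℤ) : constDiff (RatFunc.X ^ k) = 0 := by
  rw [constDiff_apply, map_zpow₀, reciprocal_X, inv_zpow', constTermZero_X_zpow,
    constTermZero_X_zpow]
  simp

theorem denom_eq_X_pow {g : RatFunc ℂ} (hg : ∀ c, c ≠ 0 → ¬ HasPoleAt g c) :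
    ∃ n : ℕ, g.denom = X ^ n := by
  have hroots : g.denom.roots = Multiset.replicate (Multiset.card g.denom.roots) 0 := by
    rw [Multiset.eq_replicate]
    refine ⟨rfl, fun c hc => ?_⟩
    by_contra hc0
    exact hg c hc0 (isRoot_of_mem_roots hc)
  have h := (IsAlgClosed.splits g.denom).eq_prod_roots_of_monic (RatFunc.monic_denom g)
  rw [hroots] at h
  exact ⟨_, by simpa using h⟩

/-- Such a `g` is a Laurent polynomial, and its expansions at `0` and `∞` have the same constant
term. -/
theorem constDiff_eq_zero {g : RatFunc ℂ} (hg : ∀ c, c ≠ 0 → ¬ HasPoleAt g c) :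
    constDiff g = 0 := by
  obtain ⟨n, hn⟩ := denom_eq_X_pow hg
  have hX : (RatFunc.X : RatFunc ℂ) ≠ 0 := RatFunc.X_ne_zero
  rw [← RatFunc.num_div_denom g, hn, g.num.as_sum_range_C_mul_X_pow, map_sum, Finset.sum_div,
    map_sum]
  refine Finset.sum_eq_zero fun i _ => ?_
  rw [map_mul, map_pow, map_pow, RatFunc.algebraMap_C, RatFunc.algebraMap_X, mul_div_assoc,
    constDiff_C_mul, ← zpow_natCast, ← zpow_natCast, ← zpow_sub₀ hX, constDiff_X_zpow, mul_zero]

theorem hasValueAt_unif (c d : ℂ) : HasValueAt c (c - d) (unif d) := by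
  have h := HasValueAt.poly (c := c) (X - C d)
  rwa [← unif_eq, eval_sub, eval_X, eval_C] at h

theorem constDiff_inv_unif {c : ℂ} (hc : c ≠ 0) : constDiff (unif c)⁻¹ = -c⁻¹ := by
  have h0 : constTermZero (unif c)⁻¹ = (0 - c)⁻¹ :=
    constTermZero_of_hasValueAt ((hasValueAt_unif 0 c).inv (by simpa using hc))
  have h1 : HasValueAt 0 (0 * (1 + -c * 0)⁻¹)
      (RatFunc.X * (RatFunc.C 1 + RatFunc.C (-c) * RatFunc.X)⁻¹) :=
    HasValueAt.var.mul (((HasValueAt.const 1).add ((HasValueAt.const (-c)).mul .var)).inv (by simp))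
  have h2 : reciprocal (unif c)⁻¹ = RatFunc.X * (RatFunc.C 1 + RatFunc.C (-c) * RatFunc.X)⁻¹ := by
    have hX : (RatFunc.X : RatFunc ℂ) ≠ 0 := RatFunc.X_ne_zero
    rw [map_inv₀, unif, map_sub, reciprocal_X, reciprocal_C, map_one, map_neg, inv_eq_iff_eq_inv,
      mul_inv, inv_inv]
    field_simp
    ring
  rw [constDiff_apply, h0, h2, constTermZero_of_hasValueAt h1, zero_sub, zero_mul, sub_zero,
    inv_neg]

/-- The residue theorem for `g / t`, when all poles of `g` in `ℂ ∖ {0}` are simple. -/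
theorem constDiff_eq_sum {g : RatFunc ℂ} {ρ : ℂ → ℂ} (hρ : ∀ c, c ≠ 0 → LeadAt c (-1) (ρ c) g)
    {S : Finset ℂ} (hS : ∀ c, c ∈ S ↔ c ≠ 0 ∧ ρ c ≠ 0) :
    constDiff g = -∑ c ∈ S, ρ c / c := by
  set s := ∑ c ∈ S, RatFunc.C (ρ c) * (unif c)⁻¹ with hs
  have hpart : ∀ c d, c ≠ d → LeadAt c (-1) 0 (RatFunc.C (ρ d) * (unif d)⁻¹) := fun c d hcd =>
    ((LeadAt.ofValue ((hasValueAt_unif c d).inv (sub_ne_zero.2 hcd))).const_mul _).lower (by omega)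
  have hsum : ∀ (U : Finset ℂ) c, c ∉ U →
      LeadAt c (-1) 0 (∑ d ∈ U, RatFunc.C (ρ d) * (unif d)⁻¹) := by
    classical
    intro U c
    induction U using Finset.induction_on with
    | empty => exact fun _ => by simpa using LeadAt.zero
    | insert d U hd ih =>
      intro hc
      rw [Finset.mem_insert, not_or] at hc
      rw [Finset.sum_insert hd]
      exact ((hpart c d hc.1).add (ih hc.2)).congr rfl (add_zero 0) rfl
  -- Subtracting the principal parts at the points of `S` leaves a Laurent polynomial.
  have hreg : ∀ c, c ≠ 0 → ¬ HasPoleAt (g - s) c := by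
    classical
    intro c hc
    rw [not_hasPoleAt_iff]
    have hlead : LeadAt c (-1) 0 (g - s) := by
      by_cases hcS : c ∈ S
      · rw [hs, ← Finset.add_sum_erase S _ hcS]
        exact ((hρ c hc).sub (((LeadAt.zpow (-1)).const_mul (ρ c)).add
          (hsum _ c (Finset.notMem_erase c S)))).congr rfl (by ring) (by rw [zpow_neg_one])
      · have h0 : ρ c = 0 := by
          by_contra h
          exact hcS ((hS c).2 ⟨hc, h⟩)
        exact ((hρ c hc).sub (hsum S c hcS)).congr rfl (by rw [h0, sub_zero]) rfl
    exact hlead.lift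
  have h := constDiff_eq_zero hreg
  rw [map_sub, sub_eq_zero] at h
  rw [h, hs, map_sum, ← Finset.sum_neg_distrib]
  refine Finset.sum_congr rfl fun c hc => ?_
  rw [constDiff_C_mul, constDiff_inv_unif ((hS c).1 hc).1]
  ring

theorem finite_residues {g : RatFunc ℂ} {ρ : ℂ → ℂ} (hρ : ∀ c, c ≠ 0 → LeadAt c (-1) (ρ c) g) :
    ∃ S : Finset ℂ, ∀ c, c ∈ S ↔ c ≠ 0 ∧ ρ c ≠ 0 := by
  classical
  refine ⟨g.denom.roots.toFinset.filter fun c => c ≠ 0 ∧ ρ c ≠ 0, fun c => ?_⟩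
  rw [Finset.mem_filter, Multiset.mem_toFinset, and_iff_right_iff_imp]
  rintro ⟨hc, hne⟩
  rw [mem_roots g.denom_ne_zero]
  by_contra hp
  obtain ⟨a, ha⟩ := (not_hasPoleAt_iff c g).1 hp
  exact hne ((hρ c hc).unique (ha.lower (by omega)))

end PainleveA5

/-! ### Summation of the residues. -/

theorem proposition4p5 (α : ZMod 6 → ℂ) (f : ZMod 6 → RatFunc ℂ)
    (hf : PainleveA5.IsRationalSolution α f) :
    ((∃ i : ZMod 6, ∃ c : ℂ, c ≠ 0 ∧ PainleveA5.HasPoleAt (f i) c) →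
      ∃ n : ℤ, n < 0 ∧
        6 * (PainleveA5.constTermZero (PainleveA5.auxH α f)
          - PainleveA5.constTermInfty (PainleveA5.auxH α f)) = (n : ℂ)) ∧
    (PainleveA5.constTermZero (PainleveA5.auxH α f)
        - PainleveA5.constTermInfty (PainleveA5.auxH α f) = 0 →
      ∀ i : ZMod 6, ∀ c : ℂ, c ≠ 0 → PainleveA5.IsRegularAt (f i) c) := by
  have first : (∃ i : ZMod 6, ∃ c : ℂ, c ≠ 0 ∧ PainleveA5.HasPoleAt (f i) c) →
      ∃ n : ℤ, n < 0 ∧ 6 * PainleveA5.constDiff (PainleveA5.auxH α f) = (n : ℂ) := by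
    rintro ⟨i, c, hc, hpole⟩
    have hm : ∀ c : ℂ, ∃ m : ℕ, c ≠ 0 → (m = 0 → ∀ i, ¬ PainleveA5.HasPoleAt (f i) c) ∧
        PainleveA5.LeadAt c (-1) (m * (c / 12)) (PainleveA5.auxH α f) := fun c => by
      by_cases hc : c = 0
      -- An arbitrary value: `S` does not contain `0`.
      · exact ⟨0, fun h => absurd hc h⟩
      · obtain ⟨m, h⟩ := hf.auxH_leadAt hc
        exact ⟨m, fun _ => h⟩
    choose m hm using hm
    have hlead := fun c hc => (hm c hc).2
    obtain ⟨S, hS⟩ := PainleveA5.finite_residues hlead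
    have hS' : ∀ c, c ∈ S ↔ c ≠ 0 ∧ m c ≠ 0 := fun c => by
      rw [hS c]
      refine and_congr_right fun hc => ?_
      simp [hc]
    -- `H` is even, so its residues at `c` and `-c` are opposite, as are the factors `c / 12` and
    -- `-c / 12`.
    have hneg : ∀ c, c ≠ 0 → m (-c) = m c := fun c hc => by
      have h1 := (hlead c hc).reflection
      rw [hf.reflection_auxH] at h1
      have h2 := h1.unique (hlead (-c) (neg_ne_zero.2 hc))
      have h3 : (m (-c) : ℂ) = m c := by
        apply mul_right_cancel₀ (show c / 12 ≠ 0 by simpa using hc)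
        rw [zpow_neg_one, inv_neg, inv_one] at h2
        linear_combination h2
      exact_mod_cast h3
    have heven : Even (∑ c ∈ S, m c) := by
      rw [← ZMod.natCast_eq_zero_iff_even, Nat.cast_sum]
      -- Modulo two, the terms at `c` and `-c` cancel, and `c ↦ -c` has no fixed point off `0`.
      refine Finset.sum_involution (fun c _ => -c) (fun c hcS => ?_) (fun c hcS _ h => ?_)
        (fun c hcS => ?_) (fun c _ => neg_neg c)
      · rw [hneg c ((hS c).1 hcS).1]
        exact CharTwo.add_self_eq_zero _
      · exact ((hS c).1 hcS).1 (self_eq_neg.1 h.symm)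
      · have h := (hS' c).1 hcS
        exact (hS' (-c)).2 ⟨neg_ne_zero.2 h.1, by rw [hneg c h.1]; exact h.2⟩
    obtain ⟨k, hk⟩ := heven
    have hpos : 0 < ∑ c ∈ S, m c := by
      have hmc : m c ≠ 0 := fun h0 => (hm c hc).1 h0 i hpole
      exact Finset.sum_pos' (fun _ _ => Nat.zero_le _)
        ⟨c, (hS' c).2 ⟨hc, hmc⟩, Nat.pos_of_ne_zero hmc⟩
    -- With `∑ m = k + k`, the value is `-6 * (2 * k) / 12 = -k`.
    refine ⟨-k, by omega, ?_⟩
    rw [PainleveA5.constDiff_eq_sum hlead hS]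
    have h1 : ∑ c ∈ S, (m c : ℂ) * (c / 12) / c = (∑ c ∈ S, m c : ℕ) / 12 := by
      rw [Nat.cast_sum, Finset.sum_div]
      refine Finset.sum_congr rfl fun c hcS => ?_
      have := ((hS c).1 hcS).1
      field_simp
    rw [h1, hk]
    push_cast
    ring
  refine ⟨first, fun h0 i c hc hpole => ?_⟩
  obtain ⟨n, hn, h⟩ := first ⟨i, c, hc, hpole⟩
  have h0' : PainleveA5.constDiff (PainleveA5.auxH α f) = 0 := h0
  rw [h0', mul_zero, eq_comm] at h
  have : n = 0 := by exact_mod_cast h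
  omega
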